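/- Let $\Omega_0\subset\mathbb R^2$ be a non-empty open convex set that contains no lines, let $\Omega_1\subset\mathbb R^2$ be an open convex set with $\operatorname{cl}\Omega_1\subset\Omega_0$, and put $\Omega=\operatorname{cl}\Omega_0\setminus\Omega_1$. For $w\subset\mathbb R^2$, let the fixed boundary $\partial_{\mathrm{fixed}}w$ be the set of all $x\in\partial w$ such that no non-degenerate open segment $\ell\subset\operatorname{cl}w$ contains $x$. A function $G\colon w\to\mathbb R\cup\{+\infty\}$ is called locally concave on $w$ if its restriction to every segment contained in $w$ is concave. For $f\colon\partial_{\mathrm{fixed}}w\to\mathbb R$ put $$\mathfrak B_{w,f}(x)=\inf\big\{G(x)\;\big|\;G\colon w\to\mathbb R\cup\{+\infty\}\text{ is locally concave on }w,\ G\ge f\text{ on }\partial_{\mathrm{fixed}}w\big\},\qquad x\in w.$$ Assume that 1. neither $\partial\Omega_0$ nor $\partial\Omega_1$ contains a (non-degenerate) linear segment; 2. the boundary of $\Omega_1$ is $C^2$-smooth; 3. $\Omega_0$ is unbounded and every ray contained in $\Omega_0$ can be translated so that it lies entirely in $\Omega_1$. An extension of $\Omega$ is a domain $\tilde\Omega=\operatorname{cl}\Omega_0\setminus\tilde\Omega_1$,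 where $\tilde\Omega_1$ is an open convex set with $\operatorname{cl}\tilde\Omega_1\subset\Omega_1$ such that conditions 1 and 3 hold with $\tilde\Omega_1$ in place of $\Omega_1$. (Under these conditions $\partial_{\mathrm{fixed}}\Omega=\partial_{\mathrm{fixed}}\tilde\Omega=\partial\Omega_0$.) **Theorem.** Suppose in addition that $\partial_{\mathrm{fixed}}\Omega$ is $C^2$-smooth and that $f\colon\partial_{\mathrm{fixed}}\Omega\to\mathbb R$ is continuous (in particular, $f$ may be any function of class $C^2$ on $\partial_{\mathrm{fixed}}\Omega$). Then for every $x\in\Omega$ $$\mathfrak B_{\Omega,f}(x)=\inf\big\{\mathfrak B_{\tilde\Omega,f}(x)\;\big|\;\tilde\Omega\text{ is an extension of }\Omega\big\},$$ as an equality in $[-\infty,+\infty]$ (both sides may be $+\infty$). -/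

import Mathlib

/-- The Euclidean plane. -/
abbrev Plane : Type := EuclideanSpace ℝ (Fin 2)

/-- The fixed boundary of `w`: the boundary points `x` of `w` such that no (nondegenerate) open
segment contained in the closure of `w` passes through `x`. -/
def fixedBoundary (w : Set Plane) : Set Plane :=
  {x | x ∈ frontier w ∧
    ∀ y z : Plane, y ≠ z → x ∈ openSegment ℝ y z → ¬ openSegment ℝ y z ⊆ closure w}

/-- `G : w → ℝ ∪ {+∞}` is locally concave on `w`: it is concave on every segment contained in `w`.
The values of `G` outside `w` are irrelevant. -/
def LocallyConcaveOn (w : Set Plane) (G : Plane → EReal) : Prop :=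
  (∀ x ∈ w, G x ≠ ⊥) ∧
    ∀ x y : Plane, segment ℝ x y ⊆ w → ∀ a b : ℝ, 0 < a → 0 < b → a + b = 1 →
      (a : EReal) * G x + (b : EReal) * G y ≤ G (a • x + b • y)

/-- The class of the locally concave functions on `w` that majorize `f` on the fixed boundary. -/
def locallyConcaveMajorants (w : Set Plane) (f : Plane → ℝ) : Set (Plane → EReal) :=
  {G | LocallyConcaveOn w G ∧ ∀ x ∈ fixedBoundary w, (f x : EReal) ≤ G x}

/-- The pointwise minimal locally concave function on `w` with boundary values `f`
(meaningful at the points of `w`). -/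
noncomputable def minimalLocallyConcave (w : Set Plane) (f : Plane → ℝ) (x : Plane) : EReal :=
  ⨅ G ∈ locallyConcaveMajorants w f, G x

/-- The domain `cl Ω₀ \ Ω₁`. -/
def stripDomain (Ω₀ Ω₁ : Set Plane) : Set Plane := closure Ω₀ \ Ω₁

/-- The standing assumptions on the two sets that define a domain `cl Ω₀ \ Ω₁`. -/
structure IsStripPair (Ω₀ Ω₁ : Set Plane) : Prop where
  nonempty : Ω₀.Nonempty
  isOpen_outer : IsOpen Ω₀
  convex_outer : Convex ℝ Ω₀
  no_line : ∀ p v : Plane, v ≠ 0 → ∃ t : ℝ, p + t • v ∉ Ω₀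
  isOpen_inner : IsOpen Ω₁
  convex_inner : Convex ℝ Ω₁
  closure_inner_subset : closure Ω₁ ⊆ Ω₀

/-- The set `S` contains no nondegenerate linear segment. -/
def NoSegments (S : Set Plane) : Prop :=
  ∀ x y : Plane, x ≠ y → ¬ segment ℝ x y ⊆ S

/-- The set `Ω₀` is unbounded and every ray contained in it can be translated so as to lie
entirely in `Ω₁`. -/
def RayCondition (Ω₀ Ω₁ : Set Plane) : Prop :=
  ¬ Bornology.IsBounded Ω₀ ∧
    ∀ p v : Plane, v ≠ 0 → (∀ t : ℝ, 0 ≤ t → p + t • v ∈ Ω₀) →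
      ∃ a : Plane, ∀ t : ℝ, 0 ≤ t → a + (p + t • v) ∈ Ω₁

/-- `S` is a `C²`-smooth curve: near each of its points it is the zero set of a `C²` function whose
differential does not vanish at the point. -/
def IsC2Curve (S : Set Plane) : Prop :=
  ∀ x ∈ S, ∃ (U : Set Plane) (F : Plane → ℝ), IsOpen U ∧ x ∈ U ∧ ContDiffOn ℝ 2 F U ∧
    fderiv ℝ F x ≠ 0 ∧ S ∩ U = {y | y ∈ U ∧ F y = 0}

/-- `cl Ω₀ \ V` is an extension of the domain `cl Ω₀ \ Ω₁`. -/
structure IsExtension (Ω₀ Ω₁ V : Set Plane) : Prop where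
  isOpen : IsOpen V
  convex : Convex ℝ V
  noSegments_outer : NoSegments (frontier Ω₀)
  noSegments_inner : NoSegments (frontier V)
  ray : RayCondition Ω₀ V
  closure_subset : closure V ⊆ Ω₁

open Set Filter Topology Metric

/-! Write `A` for the outer set, `W` for the inner one. Restricting a competitor from an extension
gives one inequality. For the other, a competitor `γ` on the strip must be carried, at arbitrarily
small cost at `x`, to some extension. `⊤`-values are harmless: by `LocallyConcaveOn.ne_top` a
competitor finite at one point off the outer boundary is finite everywhere, and on the outer
boundary the extended side is at most `f`.

Strict convexity of `W` makes a finite competitor continuous up to the inner boundary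
(`SegmentConcaveOn.continuousOn_sdiff`). Let `e` be a recession direction of `W`, `L = l + c` a
coercive coordinate with compact sublevels on `closure A`, and `D ≤ L` a multiple of the distance to
`W`. Near `W`, at level about `n`, the shifted function `γ(y - δₙ e)` is defined slightly inside `W`
and is uniformly close to `γ`. The extension moves the inner boundary along `e` by an amount convex
in `L` and below every relevant `δₙ` (`isExtension_shift`).

The new competitor is the pointwise minimum of `γ + ε(L - D)` on the old strip and the shifted
functions, corrected by `εL` minus small affine terms, on overlapping bands near `W`. The
corrections outweigh the continuity errors, so no piece is minimal at an edge of its patch where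
another piece must take over. Such a minimum is locally concave (`segmentConcaveOn_of_minimum`). It
is at most `γ + εL` on the old strip and at least `γ` on the outer boundary
(`exists_extension_majorant`); then `ε → 0`. -/

/-! ### Recession directions and coercive functionals. -/

/-- The direction is a limit of normalized points of `S` tending to infinity; the bound on `l`
disappears after normalization. -/
theorem exists_recession_direction {E : Type*} [NormedAddCommGroup E] [NormedSpace ℝ E]
    [FiniteDimensional ℝ E] {C S : Set E} (hC : IsClosed C) (hconv : Convex ℝ C) (hSC : S ⊆ C)
    (hS : ¬ Bornology.IsBounded S) (l : E →L[ℝ] ℝ) (s : ℝ) (hs : ∀ y ∈ S, l y ≤ s) :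
    ∃ v : E, ‖v‖ = 1 ∧ l v ≤ 0 ∧ ∀ z ∈ C, ∀ t : ℝ, 0 ≤ t → z + t • v ∈ C := by
  have hex : ∀ k : ℕ, ∃ y ∈ S, (k : ℝ) + 1 < ‖y‖ := by
    intro k
    by_contra! h
    exact hS (isBounded_iff_forall_norm_le.2 ⟨_, h⟩)
  choose y hyS hy using hex
  have hypos : ∀ k, 0 < ‖y k‖ := fun k => lt_trans (by positivity) (hy k)
  have hinv : Tendsto (fun k => ‖y k‖⁻¹) atTop (𝓝 0) := by
    apply Tendsto.inv_tendsto_atTop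
    exact tendsto_atTop_mono (fun k => (le_of_lt (by linarith [hy k] : (k : ℝ) < ‖y k‖)))
      tendsto_natCast_atTop_atTop
  have hu : ∀ k, ‖y k‖⁻¹ • y k ∈ sphere (0 : E) 1 := by
    intro k
    rw [mem_sphere_zero_iff_norm, norm_smul, norm_inv, norm_norm, inv_mul_cancel₀ (hypos k).ne']
  obtain ⟨v, hv, φ, hφ, hlim⟩ := (isCompact_sphere (0 : E) 1).tendsto_subseq hu
  have hinv' := hinv.comp hφ.tendsto_atTop
  refine ⟨v, by simpa using hv, ?_, ?_⟩
  · have h1 : Tendsto (fun k => l (‖y (φ k)‖⁻¹ • y (φ k))) atTop (𝓝 (l v)) :=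
      (l.continuous.tendsto v).comp hlim
    have h2 : Tendsto (fun k => ‖y (φ k)‖⁻¹ * s) atTop (𝓝 (0 * s)) := hinv'.mul_const s
    rw [zero_mul] at h2
    refine le_of_tendsto_of_tendsto' h1 h2 fun k => ?_
    rw [map_smul, smul_eq_mul]
    exact mul_le_mul_of_nonneg_left (hs _ (hyS _)) (inv_nonneg.2 (norm_nonneg _))
  · intro z hz t ht
    have h1 : Tendsto (fun k => (1 - t * ‖y (φ k)‖⁻¹) • z + t • (‖y (φ k)‖⁻¹ • y (φ k))) atTop
        (𝓝 ((1 - t * 0) • z + t • v)) :=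
      (((hinv'.const_mul t).const_sub 1).smul_const z).add (hlim.const_smul t)
    rw [mul_zero, sub_zero, one_smul] at h1
    refine hC.mem_of_tendsto h1 ?_
    have h3 : ∀ᶠ k in atTop, t * ‖y (φ k)‖⁻¹ < 1 := by
      have := hinv'.const_mul t
      rw [mul_zero] at this
      exact this.eventually_lt_const one_pos
    filter_upwards [h3] with k hk
    rw [smul_smul]
    exact hconv hz (hSC (hyS _)) (by linarith)
      (mul_nonneg ht (inv_nonneg.2 (norm_nonneg _))) (by ring)

/-- The recession cone `K` is closed and contains no line, so each nonzero `v ∈ K` has a functional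
nonnegative on `K` and positive at `v` (separate `-v` from `K`). By compactness of the unit vectors
of `K`, a finite sum is positive on all of them. An unbounded sublevel set would produce a recession
direction with `l v ≤ 0`. -/
theorem exists_coercive_functional {E : Type*} [NormedAddCommGroup E] [NormedSpace ℝ E]
    [FiniteDimensional ℝ E] {C : Set E} (hC : IsClosed C) (hconv : Convex ℝ C) (hne : C.Nonempty)
    (hline : ∀ p v : E, v ≠ 0 → ∃ t : ℝ, p + t • v ∉ C) :
    ∃ l : E →L[ℝ] ℝ, (∀ v, v ≠ 0 → (∀ z ∈ C, ∀ t : ℝ, 0 ≤ t → z + t • v ∈ C) → 0 < l v) ∧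
      ∀ s, Bornology.IsBounded {y ∈ C | l y ≤ s} := by
  set K : Set E := {v | ∀ z ∈ C, ∀ t : ℝ, 0 ≤ t → z + t • v ∈ C} with hK
  have hKclosed : IsClosed K := by
    have : K = ⋂ z ∈ C, ⋂ t : ℝ, ⋂ (_ : 0 ≤ t), {v | z + t • v ∈ C} := by
      ext v; simp [hK]
    rw [this]
    refine isClosed_biInter fun z _ => isClosed_iInter fun t => isClosed_iInter fun _ => ?_
    exact hC.preimage (by fun_prop)
  have hsmul : ∀ v ∈ K, ∀ a : ℝ, 0 ≤ a → a • v ∈ K := by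
    intro v hv a ha z hz t ht
    rw [smul_smul]
    exact hv z hz _ (mul_nonneg ht ha)
  have hadd : ∀ v ∈ K, ∀ w ∈ K, v + w ∈ K := by
    intro v hv w hw z hz t ht
    rw [smul_add, ← add_assoc]
    exact hw _ (hv z hz t ht) t ht
  have hK0 : (0 : E) ∈ K := fun z hz t _ => by simpa using hz
  have hKconv : Convex ℝ K := fun v hv w hw a b ha hb _ =>
    hadd _ (hsmul v hv a ha) _ (hsmul w hw b hb)
  have hneg : ∀ v ∈ K, v ≠ 0 → -v ∉ K := by
    intro v hv hv0 hnv
    obtain ⟨p, hp⟩ := hne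
    obtain ⟨t, ht⟩ := hline p v hv0
    apply ht
    rcases le_total 0 t with h | h
    · exact hv p hp t h
    · simpa using hnv p hp (-t) (by linarith)
  have hsep : ∀ v ∈ K, v ≠ 0 → ∃ f : E →L[ℝ] ℝ, (∀ k ∈ K, 0 ≤ f k) ∧ 0 < f v := by
    intro v hv hv0
    obtain ⟨f, u, hfu, hf⟩ := geometric_hahn_banach_point_closed hKconv hKclosed (hneg v hv hv0)
    have hu : u < 0 := by simpa using hf 0 hK0
    refine ⟨f, fun k hk => ?_, by rw [map_neg] at hfu; linarith⟩
    by_contra! hlt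
    have h1 := hf _ (hsmul k hk (u / f k) (div_nonneg_of_nonpos hu.le hlt.le))
    rw [map_smul, smul_eq_mul, div_mul_cancel₀ _ hlt.ne] at h1
    exact lt_irrefl _ h1
  set S : Set E := K ∩ sphere 0 1 with hS
  have hScomp : IsCompact S := (isCompact_sphere 0 1).inter_left hKclosed
  have hS0 : ∀ v ∈ S, v ≠ 0 := fun v hv => ne_of_mem_sphere hv.2 one_ne_zero
  choose! F hF0 hF using hsep
  obtain ⟨T, hTS⟩ := hScomp.elim_nhds_subcover' (fun v _ => {w | 0 < F v w})
    (fun v hv => (isOpen_lt continuous_const (F v).continuous).mem_nhds (hF v hv.1 (hS0 v hv)))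
  set l : E →L[ℝ] ℝ := ∑ v ∈ T, F v with hl
  have hpos : ∀ v ∈ S, 0 < l v := by
    intro v hv
    obtain ⟨w, hw, hvw⟩ := mem_iUnion₂.1 (hTS hv)
    rw [hl, sum_apply]
    exact Finset.sum_pos' (fun i _ => hF0 i i.2.1 (hS0 i i.2) v hv.1) ⟨w, hw, hvw⟩
  refine ⟨l, ?_, ?_⟩
  · intro v hv0 hv
    have hn : 0 < ‖v‖ := norm_pos_iff.2 hv0
    have h1 : ‖v‖⁻¹ • v ∈ S := ⟨hsmul v hv _ (inv_nonneg.2 hn.le), by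
      rw [mem_sphere_zero_iff_norm, norm_smul, norm_inv, norm_norm, inv_mul_cancel₀ hn.ne']⟩
    have h2 := hpos _ h1
    rw [map_smul, smul_eq_mul] at h2
    exact (mul_pos_iff_of_pos_left (inv_pos.2 hn)).1 h2
  · intro s
    by_contra hb
    obtain ⟨v, hv1, hv2, hv3⟩ := exists_recession_direction hC hconv
      (S := {y ∈ C | l y ≤ s}) (fun y hy => hy.1) hb l s (fun y hy => hy.2)
    exact absurd (hpos v ⟨hv3, by simpa using hv1⟩) (not_lt.2 hv2)

/-! ### Planar convex sets: rays, avoiding lines, distance, fixed boundary. -/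

/-- A ray contained in a convex set gives a recession direction of its closure. -/
theorem add_smul_mem_closure_of_ray {E : Type*} [NormedAddCommGroup E] [NormedSpace ℝ E]
    {W : Set E} (hW : Convex ℝ W) {q v : E} (hray : ∀ t : ℝ, 0 ≤ t → q + t • v ∈ closure W)
    {y : E} (hy : y ∈ closure W) {t : ℝ} (ht : 0 ≤ t) : y + t • v ∈ closure W := by
  have hinv : Tendsto (fun k : ℕ => ((k : ℝ) + 1)⁻¹) atTop (𝓝 0) := by
    simpa [one_div] using tendsto_one_div_add_atTop_nhds_zero_nat (𝕜 := ℝ)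
  have h1 : Tendsto (fun k : ℕ => (1 - ((k : ℝ) + 1)⁻¹) • y + (((k : ℝ) + 1)⁻¹ • q + t • v)) atTop
      (𝓝 ((1 - 0 : ℝ) • y + ((0 : ℝ) • q + t • v))) :=
    ((hinv.const_sub 1).smul_const y).add ((hinv.smul_const q).add_const _)
  simp only [sub_zero, one_smul, zero_smul, zero_add] at h1
  -- The approximants are convex combinations of `y` with ever farther points of the ray, taken with
  -- weight `1/(k+1)`.
  refine isClosed_closure.mem_of_tendsto h1 (Eventually.of_forall fun k => ?_)
  have hk : (0 : ℝ) < (k : ℝ) + 1 := by positivity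
  have h2 : ((k : ℝ) + 1)⁻¹ • q + t • v = ((k : ℝ) + 1)⁻¹ • (q + (((k : ℝ) + 1) * t) • v) := by
    rw [smul_add, smul_smul, ← mul_assoc, inv_mul_cancel₀ hk.ne', one_mul]
  rw [h2]
  refine hW.closure hy (hray _ (by positivity)) ?_ (by positivity) (by ring)
  have : ((k : ℝ) + 1)⁻¹ ≤ 1 := inv_le_one_of_one_le₀ (by linarith [(Nat.cast_nonneg k : (0 : ℝ) ≤ k)])
  linarith

theorem add_smul_mem_of_isOpen {E : Type*} [NormedAddCommGroup E] [NormedSpace ℝ E]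
    {W : Set E} (hW : Convex ℝ W) (hWo : IsOpen W) {v : E}
    (hray : ∀ y ∈ closure W, ∀ t : ℝ, 0 ≤ t → y + t • v ∈ closure W)
    {y : E} (hy : y ∈ W) {t : ℝ} (ht : 0 ≤ t) : y + t • v ∈ W := by
  have h := hW.openSegment_interior_closure_subset_interior (by rwa [hWo.interior_eq])
    (hray y (subset_closure hy) (2 * t) (by positivity))
  rw [hWo.interior_eq] at h
  apply h
  refine ⟨1 / 2, 1 / 2, by norm_num, by norm_num, by norm_num, ?_⟩
  module

/-- For a strictly convex set, moving in a recession direction leads from the closure into the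
interior. -/
theorem add_smul_mem_of_noSegments {W : Set Plane} (hW : Convex ℝ W) (hWo : IsOpen W)
    (hseg : NoSegments (frontier W)) {v : Plane} (hv : v ≠ 0)
    (hray : ∀ y ∈ closure W, ∀ t : ℝ, 0 ≤ t → y + t • v ∈ closure W)
    {y : Plane} (hy : y ∈ closure W) {t : ℝ} (ht : 0 < t) : y + t • v ∈ W := by
  by_contra hn
  refine hseg y (y + t • v) ?_ ?_
  · intro h
    have : t • v = 0 := by simpa using h
    exact (smul_ne_zero ht.ne' hv) this
  · intro z hz
    rw [segment_eq_image'] at hz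
    obtain ⟨θ, hθ, rfl⟩ := hz
    have e1 : y + θ • (y + t • v - y) = y + (θ * t) • v := by module
    rw [hWo.frontier_eq]
    dsimp only
    rw [e1]
    refine ⟨hray y hy _ (mul_nonneg hθ.1 ht.le), fun hin => hn ?_⟩
    have e2 : y + t • v = (y + (θ * t) • v) + ((1 - θ) * t) • v := by module
    rw [e2]
    exact add_smul_mem_of_isOpen hW hWo hray hin (mul_nonneg (by linarith [hθ.2]) ht.le)

/-- Through every point outside an open convex subset of the plane passes a line that avoids it. -/
theorem exists_line_avoiding {W : Set Plane} (hW : Convex ℝ W) (hWo : IsOpen W) {y : Plane}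
    (hy : y ∉ W) : ∃ τ : Plane, ‖τ‖ = 1 ∧ ∀ s : ℝ, y + s • τ ∉ W := by
  obtain ⟨f, hf⟩ := geometric_hahn_banach_open_point hW hWo hy
  have hker : LinearMap.ker (f : Plane →ₗ[ℝ] ℝ) ≠ ⊥ := by
    apply LinearMap.ker_ne_bot_of_finrank_lt
    simp
  obtain ⟨τ, hτ, hτ0⟩ := Submodule.exists_mem_ne_zero_of_ne_bot hker
  have hn : 0 < ‖τ‖ := norm_pos_iff.2 hτ0
  have hfτ : f τ = 0 := by simpa using hτ
  refine ⟨‖τ‖⁻¹ • τ, by rw [norm_smul, norm_inv, norm_norm, inv_mul_cancel₀ hn.ne'], ?_⟩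
  intro s hs
  have := hf _ hs
  simp [hfτ] at this

/-- Strict convexity: a second contact point would put a whole segment of the supporting line into
the frontier. -/
theorem notMem_closure_of_line_avoiding {W : Set Plane} (hW : Convex ℝ W) (hWo : IsOpen W)
    (hseg : NoSegments (frontier W)) {p τ : Plane} (hp : p ∈ closure W) (hτ : τ ≠ 0)
    (hline : ∀ s : ℝ, p + s • τ ∉ W) {s : ℝ} (hs : s ≠ 0) : p + s • τ ∉ closure W := by
  intro h
  refine hseg p (p + s • τ) (fun h' => smul_ne_zero hs hτ (by simpa using h')) ?_
  intro z hz
  rw [hWo.frontier_eq]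
  refine ⟨hW.closure.segment_subset hp h hz, ?_⟩
  rw [segment_eq_image'] at hz
  obtain ⟨θ, hθ, rfl⟩ := hz
  have e1 : p + θ • (p + s • τ - p) = p + (θ * s) • τ := by module
  dsimp only
  rw [e1]
  exact hline _

theorem infDist_midpoint_le {E : Type*} [NormedAddCommGroup E] [NormedSpace ℝ E] {W : Set E}
    (hW : Convex ℝ W) (hne : W.Nonempty) (x y : E) :
    infDist ((1 / 2 : ℝ) • x + (1 / 2 : ℝ) • y) W ≤ (infDist x W + infDist y W) / 2 := by
  refine le_of_forall_pos_lt_add fun ε hε => ?_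
  obtain ⟨a, ha, hxa⟩ := (infDist_lt_iff hne).1 (lt_add_of_pos_right (infDist x W) hε)
  obtain ⟨b, hb, hyb⟩ := (infDist_lt_iff hne).1 (lt_add_of_pos_right (infDist y W) hε)
  have hab : (1 / 2 : ℝ) • a + (1 / 2 : ℝ) • b ∈ W :=
    hW ha hb (by norm_num) (by norm_num) (by norm_num)
  refine (infDist_le_dist_of_mem hab).trans_lt ?_
  have h1 : dist ((1 / 2 : ℝ) • x + (1 / 2 : ℝ) • y) ((1 / 2 : ℝ) • a + (1 / 2 : ℝ) • b)
      ≤ dist ((1 / 2 : ℝ) • x) ((1 / 2 : ℝ) • a) + dist ((1 / 2 : ℝ) • y) ((1 / 2 : ℝ) • b) :=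
    dist_add_add_le _ _ _ _
  rw [dist_smul₀, dist_smul₀] at h1
  norm_num at h1
  linarith

/-- A strip point inside `A` lies on a short segment of a line avoiding `W`, so it is not fixed. At
a point of `frontier A`, an open segment in `closure A` cannot meet `A`, so it would lie in the
frontier. -/
theorem fixedBoundary_stripDomain {A W : Set Plane} (hA : Convex ℝ A) (hAo : IsOpen A)
    (hA_seg : NoSegments (frontier A)) (hW : Convex ℝ W) (hWo : IsOpen W)
    (hWA : closure W ⊆ A) : fixedBoundary (stripDomain A W) = frontier A := by
  have hclosed : IsClosed (stripDomain A W) := isClosed_closure.sdiff hWo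
  have hAint : interior (closure A) = A := by
    rcases A.eq_empty_or_nonempty with rfl | hne
    · simp
    · rw [hA.interior_closure_eq_interior_of_nonempty_interior (by rwa [hAo.interior_eq]),
        hAo.interior_eq]
  ext x
  constructor
  · rintro ⟨hx, hseg⟩
    rw [hclosed.frontier_eq] at hx
    rw [hAo.frontier_eq]
    refine ⟨hx.1.1, fun hxA => ?_⟩
    obtain ⟨τ, hτ, hline⟩ := exists_line_avoiding hW hWo hx.1.2
    obtain ⟨r, hr, hball⟩ := Metric.isOpen_iff.1 hAo x hxA
    refine hseg (x + (r / 2) • τ) (x + (-(r / 2)) • τ) ?_ ?_ ?_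
    · intro h
      have h2 : r • τ = 0 := by
        have h3 := sub_eq_zero.2 h
        rw [← h3]; module
      rcases smul_eq_zero.1 h2 with h | h
      · exact hr.ne' h
      · simp [h] at hτ
    · refine ⟨1 / 2, 1 / 2, by norm_num, by norm_num, by norm_num, ?_⟩
      module
    · intro z hz
      apply subset_closure
      obtain ⟨a, b, ha, hb, hab, rfl⟩ := hz
      have e1 : a • (x + (r / 2) • τ) + b • (x + (-(r / 2)) • τ) = x + ((a - b) * (r / 2)) • τ := by
        obtain rfl : b = 1 - a := by linarith
        module
      rw [e1]
      refine ⟨subset_closure (hball ?_), hline _⟩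
      rw [mem_ball_iff_norm, add_sub_cancel_left, norm_smul, hτ, mul_one, Real.norm_eq_abs,
        abs_mul, abs_of_pos (half_pos hr)]
      have : |a - b| ≤ 1 := abs_le.2 ⟨by linarith, by linarith⟩
      nlinarith
  · intro hx
    rw [hAo.frontier_eq] at hx
    refine ⟨?_, ?_⟩
    · rw [hclosed.frontier_eq]
      refine ⟨⟨hx.1, fun h => hx.2 (hWA (subset_closure h))⟩, fun h => hx.2 ?_⟩
      rw [← hAint]
      exact interior_mono sdiff_subset h
    · intro y z hyz hxyz hsub
      rw [hclosed.closure_eq] at hsub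
      have hsub' : openSegment ℝ y z ⊆ closure A := fun w hw => (hsub hw).1
      obtain ⟨b, a, hb, ha, hab, hx'⟩ := hxyz
      have hpt : ∀ s : ℝ, -a < s → s < b → x + s • (z - y) ∈ openSegment ℝ y z := by
        intro s h1 h2
        refine ⟨b - s, a + s, by linarith, by linarith, by linarith, ?_⟩
        rw [← hx']; module
      have hnot : ∀ s : ℝ, -a < s → s < b → x + s • (z - y) ∉ A := by
        intro s h1 h2 hin
        -- The point with parameter `-ks` is on the other side of `x` and still on the segment, so
        -- `x` would lie between a point of `A` and one of `closure A`, hence in `A`.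
        obtain ⟨k, hk, hk1, hk2⟩ : ∃ k : ℝ, 0 < k ∧ -a < -(k * s) ∧ -(k * s) < b := by
          have hs : 0 < |s| + 1 := by positivity
          refine ⟨min a b / (2 * (|s| + 1)), by positivity, ?_⟩
          have h5 : |min a b / (2 * (|s| + 1)) * s| < min a b := by
            rw [abs_mul, abs_of_pos (by positivity : 0 < min a b / (2 * (|s| + 1))),
              div_mul_eq_mul_div, div_lt_iff₀ (by positivity)]
            have : 0 < min a b := lt_min ha hb
            nlinarith [abs_nonneg s]
          have h6 := abs_lt.1 h5
          exact ⟨by linarith [h6.2, min_le_left a b], by linarith [h6.1, min_le_right a b]⟩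
        have h3 := hsub' (hpt _ hk1 hk2)
        have h4 := hA.openSegment_interior_closure_subset_interior (by rwa [hAo.interior_eq]) h3
        rw [hAo.interior_eq] at h4
        apply hx.2
        apply h4
        refine ⟨k / (1 + k), 1 / (1 + k), by positivity, by positivity, by field_simp; ring, ?_⟩
        have : k / (1 + k) * s - 1 / (1 + k) * (k * s) = 0 := by ring
        have h7 : k / (1 + k) + 1 / (1 + k) = 1 := by field_simp; ring
        calc (k / (1 + k)) • (x + s • (z - y)) + (1 / (1 + k)) • (x + (-(k * s)) • (z - y))
            = (k / (1 + k) + 1 / (1 + k)) • x +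
              (k / (1 + k) * s - 1 / (1 + k) * (k * s)) • (z - y) := by module
          _ = x := by rw [this, h7]; module
      have hc : 0 < min a b / 2 := half_pos (lt_min ha hb)
      have hca : min a b / 2 < a := by linarith [min_le_left a b]
      have hcb : min a b / 2 < b := by linarith [min_le_right a b]
      refine hA_seg (x + (-(min a b / 2)) • (z - y)) (x + (min a b / 2) • (z - y)) ?_ ?_
      · intro h
        have h3 := sub_eq_zero.2 h
        have h4 : (-(min a b)) • (z - y) = 0 := by rw [← h3]; module
        rcases smul_eq_zero.1 h4 with h | h
        · linarith
        · exact hyz (sub_eq_zero.1 h).symm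
      · intro w hw
        obtain ⟨α, β, hα, hβ, hαβ, rfl⟩ := hw
        have e1 : α • (x + (-(min a b / 2)) • (z - y)) + β • (x + (min a b / 2) • (z - y))
            = x + ((β - α) * (min a b / 2)) • (z - y) := by
          obtain rfl : α = 1 - β := by linarith
          module
        rw [e1, hAo.frontier_eq]
        have l1 : -a < (β - α) * (min a b / 2) := by nlinarith
        have l2 : (β - α) * (min a b / 2) < b := by nlinarith
        exact ⟨hsub' (hpt _ l1 l2), hnot _ l1 l2⟩

/-! ### Concavity from local midpoint inequalities. -/

/-- If the chord lies above `g` by `μ > 0` at `t`, subtract the chord and add the strictly concave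
`μ s(1 - s)`. Since `s(1 - s) ≤ 1/4`, the result is still negative at `t`, while it vanishes at the
ends. Its minimum is therefore interior, which the midpoint inequality and strict concavity forbid.
-/
theorem chord_le_of_midpoint_of_lowerSemicontinuousOn {g : ℝ → ℝ}
    (hlsc : LowerSemicontinuousOn g (Icc 0 1))
    (hmid : ∀ t ∈ Ioo (0 : ℝ) 1, ∃ h : ℝ, 0 < h ∧ h ≤ t ∧ h ≤ 1 - t ∧
      (g (t - h) + g (t + h)) / 2 ≤ g t) {t : ℝ} (ht : t ∈ Icc (0 : ℝ) 1) :
    (1 - t) * g 0 + t * g 1 ≤ g t := by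
  by_contra! hlt
  set μ : ℝ := (1 - t) * g 0 + t * g 1 - g t with hμ
  have hμ0 : 0 < μ := sub_pos.2 hlt
  set q : ℝ → ℝ := fun s => -((1 - s) * g 0 + s * g 1) + μ * (s * (1 - s)) with hq
  have hk : LowerSemicontinuousOn (fun s => g s + q s) (Icc 0 1) :=
    hlsc.add ((by fun_prop : Continuous q).lowerSemicontinuous.lowerSemicontinuousOn _)
  obtain ⟨s, hs, hmin⟩ := hk.exists_isMinOn ⟨t, ht⟩ isCompact_Icc
  have hst : g s + q s ≤ g t + q t := hmin ht
  have hneg : g t + q t < 0 := by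
    simp only [hq]
    nlinarith [sq_nonneg (t - 1 / 2)]
  have hs0 : s ≠ 0 := by
    rintro rfl
    simp [hq] at hst hneg
    linarith
  have hs1 : s ≠ 1 := by
    rintro rfl
    simp [hq] at hst hneg
    linarith
  have hs' : s ∈ Ioo (0 : ℝ) 1 := ⟨hs.1.lt_of_ne hs0.symm, hs.2.lt_of_ne hs1⟩
  obtain ⟨h, h0, h1, h2, h3⟩ := hmid s hs'
  have m1 : g s + q s ≤ g (s - h) + q (s - h) :=
    hmin (show s - h ∈ Icc (0 : ℝ) 1 from ⟨by linarith, by linarith [hs.2]⟩)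
  have m2 : g s + q s ≤ g (s + h) + q (s + h) :=
    hmin (show s + h ∈ Icc (0 : ℝ) 1 from ⟨by linarith [hs.1], by linarith⟩)
  simp only [hq] at m1 m2
  have : 0 < μ * h ^ 2 := by positivity
  nlinarith

/-- On each side of `t₀` the function lies above the chord to that end of the interval, and the
chord tends to `g t₀`. Endpoints are included. -/
theorem ConcaveOn.lowerSemicontinuousOn_Icc {a b : ℝ} {g : ℝ → ℝ} (hg : ConcaveOn ℝ (Icc a b) g) :
    LowerSemicontinuousOn g (Icc a b) := by
  have key : ∀ t₀ ∈ Icc a b, ∀ e ∈ Icc a b, ∀ t ∈ segment ℝ t₀ e,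
      g t₀ + (t - t₀) / (e - t₀) * (g e - g t₀) ≤ g t := by
    intro t₀ ht₀ e he t ht
    obtain ⟨x, y, hx, hy, hxy, rfl⟩ := ht
    rcases eq_or_ne e t₀ with rfl | hne
    · simp only [sub_self, mul_zero, add_zero]
      rw [← add_smul, hxy, one_smul]
    · have h1 := hg.2 ht₀ he hx hy hxy
      have hne' : e - t₀ ≠ 0 := sub_ne_zero.2 hne
      have h2 : (x • t₀ + y • e - t₀) / (e - t₀) = y := by
        rw [div_eq_iff hne', smul_eq_mul, smul_eq_mul, ← sub_eq_of_eq_add hxy.symm]; ring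
      rw [h2]
      refine le_trans (le_of_eq ?_) h1
      rw [smul_eq_mul, smul_eq_mul, ← sub_eq_of_eq_add hxy.symm]; ring
  intro t₀ ht₀ c hc
  have side : ∀ e ∈ Icc a b, ∀ᶠ t in 𝓝[segment ℝ t₀ e] t₀, c < g t := by
    intro e he
    have hcont : Continuous fun t => g t₀ + (t - t₀) / (e - t₀) * (g e - g t₀) := by fun_prop
    have h1 : ∀ᶠ t in 𝓝 t₀, c < g t₀ + (t - t₀) / (e - t₀) * (g e - g t₀) := by
      apply (hcont.tendsto t₀).eventually_const_lt
      simpa using hc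
    filter_upwards [nhdsWithin_le_nhds h1, self_mem_nhdsWithin] with t h2 h3
    exact h2.trans_le (key t₀ ht₀ e he t h3)
  have hab : a ≤ b := ht₀.1.trans ht₀.2
  have hun : Icc a b = segment ℝ t₀ a ∪ segment ℝ t₀ b := by
    rw [segment_symm ℝ t₀ a, segment_eq_Icc ht₀.1, segment_eq_Icc ht₀.2,
      Icc_union_Icc_eq_Icc ht₀.1 ht₀.2]
  rw [hun, nhdsWithin_union]
  exact Filter.eventually_sup.2 ⟨side a ⟨le_rfl, hab⟩, side b ⟨hab, le_rfl⟩⟩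

/-- A real function that is concave on every segment contained in `w`. -/
def SegmentConcaveOn (w : Set Plane) (γ : Plane → ℝ) : Prop :=
  ∀ x y : Plane, segment ℝ x y ⊆ w → ∀ a b : ℝ, 0 < a → 0 < b → a + b = 1 →
    a * γ x + b * γ y ≤ γ (a • x + b • y)

theorem SegmentConcaveOn.locallyConcaveOn {w : Set Plane} {γ : Plane → ℝ}
    (h : SegmentConcaveOn w γ) : LocallyConcaveOn w fun p => (γ p : EReal) := by
  refine ⟨fun x _ => EReal.coe_ne_bot _, fun x y hxy a b ha hb hab => ?_⟩
  dsimp only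
  exact_mod_cast h x y hxy a b ha hb hab

theorem LocallyConcaveOn.segmentConcaveOn_toReal {w : Set Plane} {G : Plane → EReal}
    (h : LocallyConcaveOn w G) (htop : ∀ x ∈ w, G x ≠ ⊤) :
    SegmentConcaveOn w fun p => (G p).toReal := by
  intro x y hxy a b ha hb hab
  have hx := hxy (left_mem_segment ℝ x y)
  have hy := hxy (right_mem_segment ℝ x y)
  have hz := hxy ⟨a, b, ha.le, hb.le, hab, rfl⟩
  have h1 := h.2 x y hxy a b ha hb hab
  rw [← EReal.coe_toReal (htop x hx) (h.1 x hx), ← EReal.coe_toReal (htop y hy) (h.1 y hy),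
    ← EReal.coe_toReal (htop _ hz) (h.1 _ hz)] at h1
  exact_mod_cast h1

theorem SegmentConcaveOn.concaveOn {w S : Set Plane} {γ : Plane → ℝ} (h : SegmentConcaveOn w γ)
    (hS : Convex ℝ S) (hSw : S ⊆ w) : ConcaveOn ℝ S γ := by
  refine ⟨hS, fun x hx y hy a b ha hb hab => ?_⟩
  rcases ha.eq_or_lt with rfl | ha
  · obtain rfl : b = 1 := by linarith
    simp
  rcases hb.eq_or_lt with rfl | hb
  · obtain rfl : a = 1 := by linarith
    simp
  exact h x y ((hS.segment_subset hx hy).trans hSw) a b ha hb hab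

theorem SegmentConcaveOn.concaveOn_line {w : Set Plane} {γ : Plane → ℝ}
    (h : SegmentConcaveOn w γ) {T : Set ℝ} (hT : Convex ℝ T) {p v : Plane}
    (hTw : ∀ t ∈ T, p + t • v ∈ w) : ConcaveOn ℝ T fun t => γ (p + t • v) := by
  have himg : Convex ℝ ((fun t : ℝ => p + t • v) '' T) := by
    have := hT.is_linear_image (f := fun t : ℝ => t • v) ⟨fun a b => add_smul a b v, fun c x => by simp [mul_smul]⟩
    have h2 := this.translate p
    rwa [image_image] at h2
  have h1 := h.concaveOn himg (by rintro _ ⟨t, ht, rfl⟩; exact hTw t ht)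
  refine ⟨hT, fun x hx y hy a b ha hb hab => ?_⟩
  have h2 := h1.2 (mem_image_of_mem _ hx) (mem_image_of_mem _ hy) ha hb hab
  refine h2.trans (le_of_eq ?_)
  congr 1
  obtain rfl : b = 1 - a := by linarith
  simp only [smul_eq_mul]
  module

/-- A function which is locally the minimum of finitely many functions, each of them concave near
the points where it is minimal, is locally concave. -/
theorem segmentConcaveOn_of_minimum {ι : Type*} {X : Set Plane} {H : Plane → ℝ}
    {A : ι → Set Plane} {g : ι → Plane → ℝ}
    (hex : ∀ y ∈ X, ∃ i, y ∈ A i ∧ H y = g i y)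
    (hle : ∀ y ∈ X, ∀ i, y ∈ A i → H y ≤ g i y)
    (hmid : ∀ i, ∀ y ∈ X, y ∈ A i → H y = g i y → ∀ w : Plane,
      (∀ s ∈ Icc (-1 : ℝ) 1, y + s • w ∈ X) → ∃ h : ℝ, 0 < h ∧ h ≤ 1 ∧ y + (-h) • w ∈ A i ∧
        y + h • w ∈ A i ∧ (g i (y + (-h) • w) + g i (y + h • w)) / 2 ≤ g i y)
    (hfin : ∀ y ∈ X, ∃ I : Set ι, I.Finite ∧ ∀ᶠ z in 𝓝 y, ∀ i, z ∈ A i → i ∈ I)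
    (hlsc : ∀ i, ∀ x y : Plane, segment ℝ x y ⊆ X → ∀ t₀ ∈ Icc (0 : ℝ) 1,
      ∀ c < H (x + t₀ • (y - x)), ∀ᶠ t in 𝓝[Icc 0 1] t₀,
        x + t • (y - x) ∈ A i → c < g i (x + t • (y - x))) :
    SegmentConcaveOn X H := by
  intro x y hxy a b ha hb hab
  have hX : ∀ t ∈ Icc (0 : ℝ) 1, x + t • (y - x) ∈ X := by
    intro t ht
    apply hxy
    rw [segment_eq_image']
    exact mem_image_of_mem _ ht
  have h1 : LowerSemicontinuousOn (fun t : ℝ => H (x + t • (y - x))) (Icc 0 1) := by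
    intro t₀ ht₀ c hc
    obtain ⟨I, hI, hev⟩ := hfin _ (hX t₀ ht₀)
    have hcont : Tendsto (fun t : ℝ => x + t • (y - x)) (𝓝[Icc 0 1] t₀)
        (𝓝 (x + t₀ • (y - x))) :=
      ((by fun_prop : Continuous fun t : ℝ => x + t • (y - x)).tendsto t₀).mono_left
        nhdsWithin_le_nhds
    have hall : ∀ᶠ t in 𝓝[Icc 0 1] t₀, ∀ i ∈ I, x + t • (y - x) ∈ A i →
        c < g i (x + t • (y - x)) :=
      (hI.eventually_all).2 fun i _ => hlsc i x y hxy t₀ ht₀ c hc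
    filter_upwards [hall, hcont.eventually hev, self_mem_nhdsWithin] with t h1 h2 h3
    obtain ⟨i, hi, hHi⟩ := hex _ (hX t h3)
    rw [hHi]
    exact h1 i (h2 i hi) hi
  have h2 := chord_le_of_midpoint_of_lowerSemicontinuousOn h1 (t := b) ?_
    ⟨hb.le, by linarith⟩
  · have e1 : x + b • (y - x) = a • x + b • y := by
      obtain rfl : a = 1 - b := by linarith
      module
    obtain rfl : a = 1 - b := by linarith
    simpa [e1] using h2
  · intro t ht
    have hm : 0 < min t (1 - t) := lt_min ht.1 (by linarith [ht.2])
    set m := min t (1 - t) with hmdef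
    have hmt : m ≤ t := min_le_left _ _
    have hmt' : m ≤ 1 - t := min_le_right _ _
    have htX := hX t ⟨ht.1.le, ht.2.le⟩
    obtain ⟨i, hi, hHi⟩ := hex _ htX
    obtain ⟨h, h0, hle1, hA1, hA2, hmid'⟩ := hmid i _ htX hi hHi (m • (y - x)) (by
      intro s hs
      have : x + t • (y - x) + s • m • (y - x) = x + (t + s * m) • (y - x) := by module
      rw [this]
      exact hX _ ⟨by nlinarith [hs.1], by nlinarith [hs.2]⟩)
    have e1 : x + t • (y - x) + (-h) • m • (y - x) = x + (t - h * m) • (y - x) := by module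
    have e2 : x + t • (y - x) + h • m • (y - x) = x + (t + h * m) • (y - x) := by module
    rw [e1] at hA1 hmid'
    rw [e2] at hA2 hmid'
    have hhm : h * m ≤ m := mul_le_of_le_one_left hm.le hle1
    refine ⟨h * m, by positivity, by linarith, by linarith, ?_⟩
    have l1 := hle _ (hX (t - h * m) ⟨by linarith, by linarith [ht.2, mul_pos h0 hm]⟩) i hA1
    have l2 := hle _ (hX (t + h * m) ⟨by linarith [ht.1, mul_pos h0 hm], by linarith⟩) i hA2
    rw [hHi]
    linarith

/-! ### Continuity up to the inner boundary. -/

theorem SegmentConcaveOn.continuousAt_of_mem {w U : Set Plane} {γ : Plane → ℝ}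
    (h : SegmentConcaveOn w γ) (hU : IsOpen U) (hUw : U ⊆ w) {p : Plane} (hp : p ∈ U) :
    ContinuousAt γ p := by
  obtain ⟨r, hr, hball⟩ := Metric.isOpen_iff.1 hU p hp
  exact ((h.concaveOn (convex_ball p r) (hball.trans hUw)).continuousOn isOpen_ball).continuousAt
    (ball_mem_nhds p hr)

/-- The limit line supports `W` at `p` and leaves `closure W` immediately, so `γ` is continuous at
its other points near `p`. Concavity along the lines through `y k` transfers this control to `γ (y
k)`: values at `±s` bound it below, values at `s` and `r` bound it above. Then `s → 0`, using
continuity along the limit line. -/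
theorem SegmentConcaveOn.tendsto_of_lines {w O W : Set Plane} {γ : Plane → ℝ}
    (h : SegmentConcaveOn w γ) (hO : IsOpen O) (hOw : O \ W ⊆ w) (hW : Convex ℝ W)
    (hWo : IsOpen W) (hseg : NoSegments (frontier W)) {p : Plane} (hpO : p ∈ O)
    (hpW : p ∈ closure W) {y τ : ℕ → Plane} {τ₀ : Plane}
    (hy : Tendsto y atTop (𝓝 p)) (hτ : Tendsto τ atTop (𝓝 τ₀)) (hτ1 : ∀ k, ‖τ k‖ = 1)
    (hline : ∀ᶠ k in atTop, ∀ s : ℝ, y k + s • τ k ∉ W) :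
    Tendsto (fun k => γ (y k)) atTop (𝓝 (γ p)) := by
  obtain ⟨R, hR, hball⟩ := Metric.isOpen_iff.1 hO p hpO
  obtain ⟨r, hr, hrR⟩ : ∃ r : ℝ, 0 < r ∧ 2 * r < R := ⟨R / 4, by positivity, by linarith⟩
  have hτ₀ : ‖τ₀‖ = 1 :=
    tendsto_nhds_unique hτ.norm (by simp only [hτ1]; exact tendsto_const_nhds)
  have hτ₀0 : τ₀ ≠ 0 := fun h0 => by simp [h0] at hτ₀
  have hlim : ∀ s : ℝ, Tendsto (fun k => y k + s • τ k) atTop (𝓝 (p + s • τ₀)) := fun s =>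
    hy.add (hτ.const_smul s)
  have hp_line : ∀ s : ℝ, p + s • τ₀ ∉ W := fun s =>
    hWo.isClosed_compl.mem_of_tendsto (hlim s) (hline.mono fun k hk => hk s)
  have hp_mem : ∀ s : ℝ, |s| < R → p + s • τ₀ ∈ O := by
    intro s hs
    apply hball
    rwa [mem_ball_iff_norm, add_sub_cancel_left, norm_smul, hτ₀, mul_one, Real.norm_eq_abs]
  have hφlim : ∀ s : ℝ, s ≠ 0 → |s| < R →
      Tendsto (fun k => γ (y k + s • τ k)) atTop (𝓝 (γ (p + s • τ₀))) := by
    intro s hs0 hsR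
    have hc : ContinuousAt γ (p + s • τ₀) := by
      refine h.continuousAt_of_mem (hO.sdiff isClosed_closure)
        ((sdiff_subset_sdiff_right subset_closure).trans hOw) ⟨hp_mem s hsR, ?_⟩
      exact notMem_closure_of_line_avoiding hW hWo hseg hpW hτ₀0 hp_line hs0
    exact hc.tendsto.comp (hlim s)
  have hφc : ContinuousAt (fun s : ℝ => γ (p + s • τ₀)) 0 := by
    have := h.concaveOn_line (convex_Ioo (-R) R) (p := p) (v := τ₀) (fun t ht =>
      hOw ⟨hp_mem t (abs_lt.2 ht), hp_line t⟩)
    exact (this.continuousOn isOpen_Ioo).continuousAt (Ioo_mem_nhds (by linarith) hR)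
  have hseg_k : ∀ᶠ k in atTop, ∀ s : ℝ, |s| ≤ r → y k + s • τ k ∈ w := by
    have h1 : ∀ᶠ k in atTop, y k ∈ ball p r := hy.eventually (ball_mem_nhds p hr)
    filter_upwards [h1, hline] with k hk hk' s hs
    refine hOw ⟨hball ?_, hk' s⟩
    rw [mem_ball_iff_norm] at hk ⊢
    calc ‖y k + s • τ k - p‖ = ‖(y k - p) + s • τ k‖ := by congr 1; module
      _ ≤ ‖y k - p‖ + ‖s • τ k‖ := norm_add_le _ _
      _ < R := by rw [norm_smul, hτ1, mul_one, Real.norm_eq_abs]; linarith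
  have hconc : ∀ᶠ k in atTop, ConcaveOn ℝ (Icc (-r) r) fun s : ℝ => γ (y k + s • τ k) := by
    filter_upwards [hseg_k] with k hk
    exact h.concaveOn_line (convex_Icc _ _) fun t ht => hk t (abs_le.2 ht)
  have hid : Tendsto (fun s : ℝ => s) (𝓝[>] 0) (𝓝 0) := tendsto_id.mono_left nhdsWithin_le_nhds
  have hφ0 : Tendsto (fun s : ℝ => γ (p + s • τ₀)) (𝓝 0) (𝓝 (γ p)) := by
    simpa using hφc.tendsto
  have hsmall : ∀ᶠ s : ℝ in 𝓝[>] 0, s ∈ Ioo 0 r := Ioo_mem_nhdsGT hr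
  rw [tendsto_order]
  constructor
  · intro a ha
    have h1 : Tendsto (fun s : ℝ => (γ (p + s • τ₀) + γ (p + (-s) • τ₀)) / 2) (𝓝[>] 0)
        (𝓝 ((γ p + γ p) / 2)) := by
      refine ((hφ0.comp hid).add (hφ0.comp ?_)).div_const 2
      simpa using hid.neg
    rw [add_self_div_two] at h1
    obtain ⟨s, hs1, hs2⟩ := ((h1.eventually_const_lt ha).and hsmall).exists
    have hsR : |s| < R := by rw [abs_of_pos hs2.1]; linarith [hs2.2]
    have h2 := ((hφlim s hs2.1.ne' hsR).add
      (hφlim (-s) (neg_ne_zero.2 hs2.1.ne') (by rwa [abs_neg]))).div_const 2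
    filter_upwards [h2.eventually_const_lt hs1, hconc] with k hk1 hk2
    have h3 := hk2.2 (x := s) (y := -s) ⟨by linarith [hs2.1, hs2.2], hs2.2.le⟩
      ⟨by linarith [hs2.1, hs2.2], by linarith [hs2.1, hs2.2]⟩
      (by norm_num : (0 : ℝ) ≤ 1 / 2) (by norm_num : (0 : ℝ) ≤ 1 / 2) (by norm_num)
    simp only [smul_eq_mul, mul_neg, add_neg_cancel, zero_smul, add_zero] at h3
    linarith
  · intro a ha
    have h1 : Tendsto (fun s : ℝ => (γ (p + s • τ₀) - s / r * γ (p + r • τ₀)) / (1 - s / r))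
        (𝓝[>] 0) (𝓝 ((γ p - 0 / r * γ (p + r • τ₀)) / (1 - 0 / r))) := by
      refine ((hφ0.comp hid).sub ((hid.div_const r).mul_const _)).div
        ((hid.div_const r).const_sub 1) (by simp)
    rw [zero_div, zero_mul, sub_zero, sub_zero, div_one] at h1
    obtain ⟨s, hs1, hs2⟩ := ((h1.eventually_lt_const ha).and hsmall).exists
    have hsR : |s| < R := by rw [abs_of_pos hs2.1]; linarith [hs2.2]
    have h2 := ((hφlim s hs2.1.ne' hsR).sub ((hφlim r hr.ne' (by
      rw [abs_of_pos hr]; linarith)).const_mul (s / r))).div_const (1 - s / r)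
    have hpos : 0 < 1 - s / r := by rw [sub_pos, div_lt_one hr]; exact hs2.2
    filter_upwards [h2.eventually_lt_const hs1, hconc] with k hk1 hk2
    have h3 := hk2.2 (x := 0) (y := r) ⟨by linarith, hr.le⟩ ⟨by linarith, le_rfl⟩
      hpos.le (div_nonneg hs2.1.le hr.le) (by ring)
    simp only [smul_eq_mul, mul_zero, zero_add, zero_smul, add_zero, div_mul_cancel₀ _ hr.ne'] at h3
    rw [div_lt_iff₀ hpos] at hk1
    by_contra! hcon
    have : a * (1 - s / r) ≤ γ (y k) * (1 - s / r) := mul_le_mul_of_nonneg_right hcon hpos.le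
    linarith

theorem SegmentConcaveOn.continuousOn_sdiff {w O W : Set Plane} {γ : Plane → ℝ}
    (h : SegmentConcaveOn w γ) (hO : IsOpen O) (hOw : O \ W ⊆ w) (hW : Convex ℝ W)
    (hWo : IsOpen W) (hseg : NoSegments (frontier W)) : ContinuousOn γ (O \ W) := by
  intro p hp
  by_cases hpW : p ∈ closure W
  -- `σ` is only a default unit direction for points of `W`, where no avoiding line exists; the
  -- sequences considered stay outside `W`.
  · obtain ⟨σ, hσ, -⟩ := exists_line_avoiding hW hWo hp.2
    have hex : ∀ y : Plane, ∃ τ : Plane, ‖τ‖ = 1 ∧ (y ∉ W → ∀ s : ℝ, y + s • τ ∉ W) := by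
      intro y
      by_cases hy : y ∈ W
      · exact ⟨σ, hσ, fun h => absurd hy h⟩
      · obtain ⟨τ, h1, h2⟩ := exists_line_avoiding hW hWo hy
        exact ⟨τ, h1, fun _ => h2⟩
    choose τ hτ1 hτ using hex
    refine tendsto_of_subseq_tendsto fun ns hns => ?_
    obtain ⟨τ₀, -, φ, hφ, hlim⟩ := (isCompact_sphere (0 : Plane) 1).tendsto_subseq
      (x := fun k => τ (ns k)) (fun k => by simpa using hτ1 (ns k))
    refine ⟨φ, ?_⟩
    have hns' := hns.comp hφ.tendsto_atTop
    refine h.tendsto_of_lines hO hOw hW hWo hseg hp.1 hpW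
      (hns'.mono_right nhdsWithin_le_nhds) hlim (fun k => hτ1 _) ?_
    filter_upwards [hns'.eventually self_mem_nhdsWithin] with k hk
    exact hτ _ hk.2
  · exact (h.continuousAt_of_mem (hO.sdiff isClosed_closure)
      ((sdiff_subset_sdiff_right subset_closure).trans hOw) ⟨hp.1, hpW⟩).continuousWithinAt

/-! ### Propagation of the value `⊤`. -/

theorem LocallyConcaveOn.eq_top_of_mem_openSegment {w : Set Plane} {G : Plane → EReal}
    (h : LocallyConcaveOn w G) {x y z : Plane} (hxy : segment ℝ x y ⊆ w) (hx : G x = ⊤)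
    (hz : z ∈ openSegment ℝ x y) : G z = ⊤ := by
  obtain ⟨a, b, ha, hb, hab, rfl⟩ := hz
  have h1 := h.2 x y hxy a b ha hb hab
  have hy : G y ≠ ⊥ := h.1 y (hxy (right_mem_segment ℝ x y))
  rw [hx, EReal.coe_mul_top_of_pos ha] at h1
  have h2 : (b : EReal) * G y ≠ ⊥ := by
    induction hG : G y with
    | bot => exact absurd hG hy
    | top => rw [EReal.coe_mul_top_of_pos hb]; exact top_ne_bot
    | coe r => exact_mod_cast EReal.coe_ne_bot (b * r)
  rw [EReal.top_add_of_ne_bot h2, top_le_iff] at h1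
  exact h1

theorem LocallyConcaveOn.eq_top_of_mem_ball {w : Set Plane} {G : Plane → EReal}
    (h : LocallyConcaveOn w G) {y z : Plane} {r : ℝ} (hb : ball y r ⊆ w) (hz : z ∈ ball y r) :
    G y = ⊤ → G z = ⊤ := by
  intro hy
  rcases eq_or_ne z y with rfl | hne
  · exact hy
  have hd : 0 < dist z y := dist_pos.2 hne
  rw [mem_ball] at hz
  have hr : 0 < r := hd.trans hz
  obtain ⟨k, hk1, hk2⟩ : ∃ k : ℝ, 1 < k ∧ k * dist z y < r := by
    refine ⟨(1 + r / dist z y) / 2, ?_, ?_⟩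
    · have := (one_lt_div hd).2 hz
      linarith
    · have : r / dist z y * dist z y = r := div_mul_cancel₀ _ hd.ne'
      nlinarith
  have hk0 : (0 : ℝ) < k := by linarith
  refine h.eq_top_of_mem_openSegment (y := y + k • (z - y)) ?_ hy ?_
  · refine ((convex_ball y r).segment_subset (mem_ball_self hr) ?_).trans hb
    rwa [mem_ball_iff_norm, add_sub_cancel_left, norm_smul, Real.norm_eq_abs, abs_of_pos hk0,
      ← dist_eq_norm]
  · refine ⟨1 - k⁻¹, k⁻¹, by rw [sub_pos]; exact inv_lt_one_of_one_lt₀ hk1, by positivity, by ring,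
      ?_⟩
    rw [smul_add, smul_smul, inv_mul_cancel₀ hk0.ne']
    module

theorem LocallyConcaveOn.isOpen_inter_eq_top {w U : Set Plane} {G : Plane → EReal}
    (h : LocallyConcaveOn w G) (hU : IsOpen U) (hUw : U ⊆ w) : IsOpen {y ∈ U | G y = ⊤} := by
  rw [Metric.isOpen_iff]
  rintro y ⟨hy, hG⟩
  obtain ⟨r, hr, hball⟩ := Metric.isOpen_iff.1 hU y hy
  exact ⟨r, hr, fun z hz => ⟨hball hz, h.eq_top_of_mem_ball (hball.trans hUw) hz hG⟩⟩

theorem LocallyConcaveOn.isOpen_inter_ne_top {w U : Set Plane} {G : Plane → EReal}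
    (h : LocallyConcaveOn w G) (hU : IsOpen U) (hUw : U ⊆ w) : IsOpen {y ∈ U | G y ≠ ⊤} := by
  rw [Metric.isOpen_iff]
  rintro y ⟨hy, hG⟩
  obtain ⟨r, hr, hball⟩ := Metric.isOpen_iff.1 hU y hy
  refine ⟨r / 2, half_pos hr, fun z hz => ⟨hball (ball_subset_ball (by linarith) hz),
    fun hGz => hG ?_⟩⟩
  rw [mem_ball] at hz
  refine h.eq_top_of_mem_ball (y := z) (r := r / 2) ?_ (by rwa [mem_ball, dist_comm]) hGz
  exact (ball_subset_ball' (by linarith)).trans (hball.trans hUw)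

theorem LocallyConcaveOn.eq_top_of_isPreconnected {w U S : Set Plane} {G : Plane → EReal}
    (h : LocallyConcaveOn w G) (hU : IsOpen U) (hUw : U ⊆ w) (hS : IsPreconnected S)
    (hSU : S ⊆ U) {y z : Plane} (hy : y ∈ S) (hz : z ∈ S) (hG : G y = ⊤) : G z = ⊤ := by
  by_contra hGz
  obtain ⟨x, -, hx1, hx2⟩ := hS _ _ (h.isOpen_inter_eq_top hU hUw) (h.isOpen_inter_ne_top hU hUw)
    (fun x hx => by
      by_cases hG : G x = ⊤
      · exact Or.inl ⟨hSU hx, hG⟩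
      · exact Or.inr ⟨hSU hx, hG⟩) ⟨y, hy, hSU hy, hG⟩ ⟨z, hz, hSU hz, hGz⟩
  exact hx2.2 hx1.2

/-- Since `A` contains no line, moving backwards along `e` from a point of `closure W` eventually
exits `A`; just before the exit the point is in `A` but away from `closure W`. -/
theorem exists_sub_smul_mem_sdiff_closure {A W : Set Plane} (hA : Convex ℝ A) (hAo : IsOpen A)
    (hline : ∀ p v : Plane, v ≠ 0 → ∃ t : ℝ, p + t • v ∉ A)
    (hWA : closure W ⊆ A) {e : Plane} (he : e ≠ 0)
    (hrec : ∀ y ∈ closure W, ∀ t : ℝ, 0 < t → y + t • e ∈ W) {y : Plane} (hy : y ∈ A) :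
    ∃ t : ℝ, 0 ≤ t ∧ y - t • e ∈ A \ closure W := by
  by_cases hyW : y ∈ closure W
  swap
  · exact ⟨0, le_rfl, by simpa using ⟨hy, hyW⟩⟩
  obtain ⟨t₀, ht₀⟩ := hline y e he
  obtain ⟨z, hz, hzf⟩ : ∃ z ∈ segment ℝ y (y + t₀ • e), z ∈ closure A \ A := by
    by_contra! hno
    obtain ⟨p, -, hp1, hp2⟩ := (convex_segment y (y + t₀ • e)).isPreconnected A (closure A)ᶜ hAo
      isClosed_closure.isOpen_compl
      (fun p hp => by
        by_cases hpA : p ∈ A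
        · exact Or.inl hpA
        · exact Or.inr fun hcl => hno p hp ⟨hcl, hpA⟩)
      ⟨y, left_mem_segment ℝ _ _, hy⟩
      ⟨_, right_mem_segment ℝ _ _, fun hcl => hno _ (right_mem_segment ℝ _ _) ⟨hcl, ht₀⟩⟩
    exact hp2 (subset_closure hp1)
  have ht₀neg : t₀ < 0 := by
    by_contra! h
    rcases h.eq_or_lt with rfl | h
    · exact ht₀ (by simpa using hy)
    · exact ht₀ (hWA (subset_closure (hrec y hyW t₀ h)))
  have hzW : z ∉ closure W := fun h => hzf.2 (hWA h)
  rw [segment_eq_image'] at hz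
  obtain ⟨θ, hθ, hzeq⟩ := hz
  have hzeq' : y + θ • (y + t₀ • e - y) = z := hzeq
  have hcont : Tendsto (fun k : ℝ => z + k • (y - z)) (𝓝[>] 0) (𝓝 (z + (0 : ℝ) • (y - z))) :=
    ((by fun_prop : Continuous fun k : ℝ => z + k • (y - z)).tendsto 0).mono_left
      nhdsWithin_le_nhds
  rw [zero_smul, add_zero] at hcont
  have h1 : ∀ᶠ k : ℝ in 𝓝[>] 0, z + k • (y - z) ∈ (closure W)ᶜ :=
    hcont (isClosed_closure.isOpen_compl.mem_nhds hzW)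
  obtain ⟨k, hk1, hk2⟩ := (h1.and (Ioo_mem_nhdsGT one_pos)).exists
  refine ⟨(1 - k) * (θ * -t₀), mul_nonneg (by linarith [hk2.2])
    (mul_nonneg hθ.1 (by linarith)), ?_⟩
  have e1 : y - ((1 - k) * (θ * -t₀)) • e = z + k • (y - z) := by rw [← hzeq']; module
  rw [e1]
  refine ⟨?_, hk1⟩
  have h2 := hA.openSegment_interior_closure_subset_interior (by rwa [hAo.interior_eq]) hzf.1
  rw [hAo.interior_eq] at h2
  exact h2 ⟨k, 1 - k, hk2.1, by linarith [hk2.2], by ring, by module⟩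

/-- Inside `A \ closure W` the sets where `G` is `⊤` and where it is finite are both open, so one of
them is empty by connectedness. Boundary points of either kind are joined to this open set by
segments within the strip; a `⊤` at an endpoint spreads to the open segment. -/
theorem LocallyConcaveOn.ne_top {A W : Set Plane} (hA : Convex ℝ A) (hAo : IsOpen A)
    (hline : ∀ p v : Plane, v ≠ 0 → ∃ t : ℝ, p + t • v ∉ A) (hW : Convex ℝ W) (hWo : IsOpen W)
    (hseg : NoSegments (frontier W)) (hWA : closure W ⊆ A) {e : Plane} (he : e ≠ 0)
    (hrec : ∀ y ∈ closure W, ∀ t : ℝ, 0 < t → y + t • e ∈ W) {G : Plane → EReal}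
    (h : LocallyConcaveOn (stripDomain A W) G) {x : Plane} (hx : x ∈ A \ W) (hGx : G x ≠ ⊤) :
    ∀ y ∈ stripDomain A W, G y ≠ ⊤ := by
  have hUo : IsOpen (A \ closure W) := hAo.sdiff isClosed_closure
  have hUw : A \ closure W ⊆ stripDomain A W :=
    fun z hz => ⟨subset_closure hz.1, fun hzW => hz.2 (subset_closure hzW)⟩
  -- the value `⊤` is constant along the fibers in direction `e`
  have hfiber : ∀ y ∈ A \ closure W, ∀ t : ℝ, 0 ≤ t → y - t • e ∈ A \ closure W →
      segment ℝ y (y - t • e) ⊆ A \ closure W := by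
    intro y hy t ht hyt z hz
    refine ⟨hA.segment_subset hy.1 hyt.1 hz, fun hzW => ?_⟩
    rw [segment_eq_image'] at hz
    obtain ⟨θ, hθ, rfl⟩ := hz
    rcases (mul_nonneg hθ.1 ht).eq_or_lt with h0 | h0
    · have e1 : y + θ • (y - t • e - y) = y - (θ * t) • e := by module
      dsimp only at hzW
      rw [e1, ← h0] at hzW
      exact hy.2 (by simpa using hzW)
    · have h2 := hrec _ hzW _ h0
      have e1 : y + θ • (y - t • e - y) + (θ * t) • e = y := by module
      dsimp only at h2
      rw [e1] at h2
      exact hy.2 (subset_closure h2)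
  -- Sweeping the two open sets forward along `e` covers `A`, so connectedness of the convex set `A`
  -- can be used in place of that of `A \ closure W`.
  have hopen : ∀ T : Set Plane, IsOpen T → IsOpen {y : Plane | ∃ t : ℝ, 0 ≤ t ∧ y - t • e ∈ T} := by
    intro T hT
    have : {y : Plane | ∃ t : ℝ, 0 ≤ t ∧ y - t • e ∈ T} =
        ⋃ t : ℝ, ⋃ (_ : 0 ≤ t), (fun y => y - t • e) ⁻¹' T := by
      ext y; simp
    rw [this]
    exact isOpen_iUnion fun t => isOpen_iUnion fun _ => hT.preimage (by fun_prop)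
  have hconst : ∀ y ∈ A \ closure W, ∀ z ∈ A \ closure W, G y = ⊤ → G z = ⊤ := by
    intro y hy z hz hGy
    by_contra hGz
    obtain ⟨p, hp, ⟨t, ht, htT⟩, ⟨s, hs, hsT⟩⟩ := hA.isPreconnected _ _
      (hopen _ (h.isOpen_inter_eq_top hUo hUw)) (hopen _ (h.isOpen_inter_ne_top hUo hUw))
      (fun p hp => by
        obtain ⟨t, ht, htU⟩ := exists_sub_smul_mem_sdiff_closure hA hAo hline hWA he hrec hp
        by_cases hG : G (p - t • e) = ⊤
        · exact Or.inl ⟨t, ht, htU, hG⟩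
        · exact Or.inr ⟨t, ht, htU, hG⟩)
      ⟨y, hy.1, 0, le_rfl, by simpa using ⟨hy, hGy⟩⟩ ⟨z, hz.1, 0, le_rfl, by simpa using ⟨hz, hGz⟩⟩
    apply hsT.2
    rcases le_total t s with hts | hts
    · have e1 : p - s • e = (p - t • e) - (s - t) • e := by module
      have h1 := hfiber _ htT.1 (s - t) (by linarith) (by rw [← e1]; exact hsT.1)
      rw [← e1] at h1
      exact h.eq_top_of_isPreconnected hUo hUw (convex_segment _ _).isPreconnected h1
        (left_mem_segment ℝ _ _) (right_mem_segment ℝ _ _) htT.2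
    · have e1 : p - t • e = (p - s • e) - (t - s) • e := by module
      have h1 := hfiber _ hsT.1 (t - s) (by linarith) (by rw [← e1]; exact htT.1)
      rw [← e1] at h1
      exact h.eq_top_of_isPreconnected hUo hUw (convex_segment _ _).isPreconnected h1
        (right_mem_segment ℝ _ _) (left_mem_segment ℝ _ _) htT.2
  -- every point of `A \ W` is the midpoint of a segment with ends in the interior
  have hmid : ∀ p ∈ A \ W, ∃ v : Plane,
      (∀ s : ℝ, s ≠ 0 → |s| ≤ 1 → p + s • v ∈ A \ closure W) ∧
      segment ℝ (p - v) (p + v) ⊆ stripDomain A W := by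
    intro p hp
    by_cases hpW : p ∈ closure W
    swap
    · refine ⟨0, fun s _ _ => by simpa using ⟨hp.1, hpW⟩, ?_⟩
      simpa using ⟨subset_closure hp.1, hp.2⟩
    obtain ⟨τ, hτ, hl⟩ := exists_line_avoiding hW hWo hp.2
    have hτ0 : τ ≠ 0 := fun h0 => by simp [h0] at hτ
    obtain ⟨r, hr, hball⟩ := Metric.isOpen_iff.1 hAo p hp.1
    have hmemA : ∀ s : ℝ, |s| < r → p + s • τ ∈ A := by
      intro s hs
      apply hball
      rwa [mem_ball_iff_norm, add_sub_cancel_left, norm_smul, hτ, mul_one, Real.norm_eq_abs]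
    have hr2 : |r / 2| < r := by rw [abs_of_pos (half_pos hr)]; linarith
    have hm : p - (r / 2) • τ = p + (-(r / 2)) • τ := by module
    have hn : ∀ s : ℝ, s ≠ 0 → p + s • τ ∉ closure W := fun s hs =>
      notMem_closure_of_line_avoiding hW hWo hseg hpW hτ0 hl hs
    refine ⟨(r / 2) • τ, fun s hs0 hs1 => ?_, ?_⟩
    · rw [smul_smul]
      refine ⟨hmemA _ ?_, hn _ (mul_ne_zero hs0 (by positivity))⟩
      rw [abs_mul]
      exact (mul_le_of_le_one_left (abs_nonneg _) hs1).trans_lt hr2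
    · intro z hz
      have hzA : z ∈ A := by
        refine hA.segment_subset ?_ (hmemA _ hr2) hz
        rw [hm]
        exact hmemA _ (by rwa [abs_neg])
      refine ⟨subset_closure hzA, ?_⟩
      rw [segment_eq_image'] at hz
      obtain ⟨θ, -, rfl⟩ := hz
      have e1 : p - (r / 2) • τ + θ • (p + (r / 2) • τ - (p - (r / 2) • τ)) =
        p + (θ * r - r / 2) • τ := by module
      dsimp only
      rw [e1]
      exact hl _
  have hU : ∀ y ∈ A \ closure W, G y ≠ ⊤ := by
    obtain ⟨v, hv, hv3⟩ := hmid x hx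
    have hv2 := hv (-1) (by norm_num) (by norm_num)
    rw [neg_one_smul, ← sub_eq_add_neg] at hv2
    intro y hy hGy
    refine hGx (h.eq_top_of_mem_openSegment hv3 (hconst y hy _ hv2 hGy) ?_)
    exact ⟨1 / 2, 1 / 2, by norm_num, by norm_num, by norm_num, by module⟩
  intro y hy hGy
  by_cases hyA : y ∈ A
  · obtain ⟨v, hv, hv3⟩ := hmid y ⟨hyA, hy.2⟩
    refine hU (y + (1 / 2 : ℝ) • v) (hv _ (by norm_num) (by norm_num [abs_of_pos]))
      (h.eq_top_of_mem_openSegment (x := y) (y := y + v) ?_ hGy ?_)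
    · refine Subset.trans ?_ hv3
      refine (convex_segment _ _).segment_subset ?_ (right_mem_segment ℝ _ _)
      exact ⟨1 / 2, 1 / 2, by norm_num, by norm_num, by norm_num, by module⟩
    · exact ⟨1 / 2, 1 / 2, by norm_num, by norm_num, by norm_num, by module⟩
  · have hyW : y ∉ closure W := fun h' => hyA (hWA h')
    have hcont : Tendsto (fun k : ℝ => y + k • (x - y)) (𝓝 0) (𝓝 (y + (0 : ℝ) • (x - y))) :=
      (by fun_prop : Continuous fun k : ℝ => y + k • (x - y)).tendsto 0
    rw [zero_smul, add_zero] at hcont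
    have h1 : ∀ᶠ k : ℝ in 𝓝 0, y + k • (x - y) ∈ (closure W)ᶜ :=
      hcont (isClosed_closure.isOpen_compl.mem_nhds hyW)
    obtain ⟨d, hd, hball⟩ := Metric.eventually_nhds_iff.1 h1
    set k : ℝ := min (d / 2) (1 / 2) with hk
    have hk0 : 0 < k := by positivity
    have hkd : k ≤ d / 2 := min_le_left _ _
    have hk1 : k ≤ 1 / 2 := min_le_right _ _
    have hcl : ∀ s : ℝ, 0 ≤ s → s ≤ k → y + s • (x - y) ∉ closure W := by
      intro s hs0 hs
      apply hball
      rw [Real.dist_eq, sub_zero, abs_of_nonneg hs0]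
      linarith
    have hin : ∀ s : ℝ, 0 < s → s ≤ k → y + s • (x - y) ∈ A := by
      intro s hs0 hs
      have h2 := hA.openSegment_interior_closure_subset_interior
        (by rw [hAo.interior_eq]; exact hx.1) hy.1
      rw [hAo.interior_eq] at h2
      exact h2 ⟨s, 1 - s, hs0, by linarith, by ring, by module⟩
    refine hU (y + (k / 2) • (x - y)) ⟨hin _ (by positivity) (by linarith),
      hcl _ (by positivity) (by linarith)⟩
      (h.eq_top_of_mem_openSegment (x := y) (y := y + k • (x - y)) ?_ hGy ?_)
    · intro z hz
      refine ⟨hA.closure.segment_subset hy.1 (subset_closure (hin k hk0 le_rfl)) hz, fun hzW => ?_⟩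
      rw [segment_eq_image'] at hz
      obtain ⟨θ, hθ, rfl⟩ := hz
      have e1 : y + θ • (y + k • (x - y) - y) = y + (θ * k) • (x - y) := by module
      dsimp only at hzW
      rw [e1] at hzW
      exact hcl _ (mul_nonneg hθ.1 hk0.le) (by nlinarith [hθ.2]) (subset_closure hzW)
    · exact ⟨1 / 2, 1 / 2, by norm_num, by norm_num, by norm_num, by module⟩

/-! ### Construction of the extension. -/

theorem exists_quarter_decreasing_le {b : ℕ → ℝ} (hb : ∀ n, 0 < b n) :
    ∃ a : ℕ → ℝ, (∀ n, 0 < a n) ∧ (∀ n, a (n + 1) ≤ a n / 4) ∧ ∀ n, a n ≤ b n := by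
  let a : ℕ → ℝ := fun n => Nat.rec (b 0) (fun n x => min (b (n + 1)) (x / 4)) n
  have ha : ∀ n, a (n + 1) = min (b (n + 1)) (a n / 4) := fun n => rfl
  refine ⟨a, fun n => ?_, fun n => ?_, fun n => ?_⟩
  · induction n with
    | zero => exact hb 0
    | succ n ih => rw [ha]; exact lt_min (hb _) (by positivity)
  · rw [ha]; exact min_le_right _ _
  · cases n with
    | zero => exact le_rfl
    | succ n => rw [ha]; exact min_le_left _ _

/-- `m` is the supremum of the decreasing affine functions `aₙ(n + 1 - s)` with `aₙ = δ(n+1)/(n+2)`.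
For `s ≥ k - 1`, the terms with `n + 1 < k` are nonpositive and the others are at most `aₙ(n + 2) =
δ(n+1) ≤ δ k`. -/
theorem exists_convex_antitone_le {δ : ℕ → ℝ} (hδ : ∀ n, 0 < δ n) (hanti : Antitone δ) :
    ∃ m : ℝ → ℝ, ConvexOn ℝ univ m ∧ Continuous m ∧ Antitone m ∧ (∀ s, 0 < m s) ∧
      ∀ (n : ℕ) (s : ℝ), (n : ℝ) ≤ s + 1 → m s ≤ δ n := by
  set a : ℕ → ℝ := fun n => δ (n + 1) / (n + 2) with ha
  have ha0 : ∀ n, 0 < a n := fun n => div_pos (hδ _) (by positivity)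
  have ha1 : ∀ n, a n * (n + 2) = δ (n + 1) := fun n => div_mul_cancel₀ _ (by positivity)
  have hbdd : ∀ s : ℝ, BddAbove (range fun n : ℕ => a n * (n + 1 - s)) := by
    intro s
    refine ⟨δ 0 * (1 + |s|), ?_⟩
    rintro _ ⟨n, rfl⟩
    have h1 : a n * (n + 2) ≤ δ 0 := by rw [ha1]; exact hanti (Nat.zero_le _)
    have h2 : (0 : ℝ) ≤ n := Nat.cast_nonneg n
    have h3 : a n ≤ δ 0 := by nlinarith [ha0 n]
    dsimp only
    nlinarith [neg_abs_le s, abs_nonneg s, ha0 n]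
  have hconv : ConvexOn ℝ univ fun s : ℝ => ⨆ n : ℕ, a n * (n + 1 - s) := by
    refine ⟨convex_univ, fun s _ t _ x y hx hy hxy => ciSup_le fun n => ?_⟩
    have h1 := mul_le_mul_of_nonneg_left (le_ciSup (hbdd s) n) hx
    have h2 := mul_le_mul_of_nonneg_left (le_ciSup (hbdd t) n) hy
    simp only [smul_eq_mul]
    refine le_trans (le_of_eq ?_) (add_le_add h1 h2)
    obtain rfl : y = 1 - x := by linarith
    ring
  refine ⟨_, hconv, continuousOn_univ.1 (hconv.continuousOn isOpen_univ), ?_, ?_, ?_⟩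
  · intro s t hst
    refine ciSup_le fun n => le_trans ?_ (le_ciSup (hbdd s) n)
    exact mul_le_mul_of_nonneg_left (by linarith) (ha0 n).le
  · intro s
    obtain ⟨n, hn⟩ := exists_nat_gt s
    exact (mul_pos (ha0 n) (by linarith)).trans_le (le_ciSup (hbdd s) n)
  · intro k s hs
    refine ciSup_le fun n => ?_
    have h0 := ha0 n
    rcases le_or_gt k (n + 1) with hk | hk
    · have h1 : a n * (n + 2) ≤ δ k := by rw [ha1]; exact hanti hk
      have h2 : (0 : ℝ) ≤ k := Nat.cast_nonneg k
      nlinarith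
    · have h1 : (n : ℝ) + 1 + 1 ≤ k := by exact_mod_cast hk
      have h2 := hδ k
      nlinarith

/-- A strip domain is extended by shifting the inner boundary in a recession direction, by an
amount that depends convexly on a coercive coordinate. -/
theorem isExtension_shift {A W : Set Plane} (hA_seg : NoSegments (frontier A))
    (hW : Convex ℝ W) (hWo : IsOpen W) (hseg : NoSegments (frontier W))
    (hray : RayCondition A W) {e : Plane} (hrec : ∀ y ∈ closure W, ∀ t : ℝ, 0 < t → y + t • e ∈ W)
    {l : Plane →L[ℝ] ℝ} {c : ℝ} (hle : 0 < l e)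
    (hl : ∀ p v : Plane, (∀ t : ℝ, 0 ≤ t → p + t • v ∈ A) → 0 ≤ l v)
    {m : ℝ → ℝ} (hm : ConvexOn ℝ univ m) (hmc : Continuous m) (hanti : Antitone m)
    (hpos : ∀ s, 0 < m s) : IsExtension A W {y | y - m (l y + c) • e ∈ W} := by
  have hrec' : ∀ y ∈ W, ∀ t : ℝ, 0 ≤ t → y + t • e ∈ W := by
    intro y hy t ht
    rcases ht.eq_or_lt with rfl | ht
    · simpa using hy
    · exact hrec y (subset_closure hy) t ht
  have hcont : Continuous fun y : Plane => y - m (l y + c) • e := by fun_prop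
  have hopen : IsOpen {y | y - m (l y + c) • e ∈ W} := hWo.preimage hcont
  have hcl : ∀ y ∈ closure {y | y - m (l y + c) • e ∈ W}, y - m (l y + c) • e ∈ closure W :=
    fun y hy =>
    map_mem_closure (f := fun y : Plane => y - m (l y + c) • e) hcont hy fun _ h => h
  -- Convexity of `m` makes the defect `d` nonnegative, so it is a displacement along the recession
  -- direction.
  have hcomb : ∀ (x y : Plane) (a b : ℝ), 0 ≤ a → 0 ≤ b → a + b = 1 → ∃ d : ℝ, 0 ≤ d ∧
      (a • x + b • y) - m (l (a • x + b • y) + c) • e =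
        (a • (x - m (l x + c) • e) + b • (y - m (l y + c) • e)) + d • e := by
    intro x y a b ha hb hab
    refine ⟨a * m (l x + c) + b * m (l y + c) - m (l (a • x + b • y) + c), ?_, by module⟩
    have h1 := hm.2 (mem_univ (l x + c)) (mem_univ (l y + c)) ha hb hab
    have h2 : a • (l x + c) + b • (l y + c) = l (a • x + b • y) + c := by
      obtain rfl : b = 1 - a := by linarith
      simp only [map_add, map_smul, smul_eq_mul]
      ring
    rw [h2] at h1
    simpa using h1
  refine ⟨hopen, ?_, hA_seg, ?_, ⟨hray.1, ?_⟩, ?_⟩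
  · intro x hx y hy a b ha hb hab
    obtain ⟨d, hd, hd'⟩ := hcomb x y a b ha hb hab
    rw [mem_ofPred_eq, hd']
    exact hrec' _ (hW hx hy ha hb hab) d hd
  · intro x y hxy hsub
    have hfr : ∀ z ∈ segment ℝ x y, z - m (l z + c) • e ∈ closure W \ W := by
      intro z hz
      have h := hsub hz
      rw [hopen.frontier_eq] at h
      exact ⟨hcl z h.1, h.2⟩
    have hx := hfr x (left_mem_segment ℝ x y)
    have hy := hfr y (right_mem_segment ℝ x y)
    refine hseg (x - m (l x + c) • e) (y - m (l y + c) • e) ?_ ?_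
    -- The shift map is injective: two points with the same image differ by a multiple of `e`, and
    -- the sign of that multiple contradicts monotonicity of `m` unless it is zero.
    · have key : ∀ p q : Plane, p - m (l p + c) • e = q - m (l q + c) • e → l p ≤ l q → p = q := by
        intro p q hpq hlpq
        have h1 : q - p = (m (l q + c) - m (l p + c)) • e := by
          rw [sub_smul, sub_eq_sub_iff_add_eq_add]
          rw [sub_eq_sub_iff_add_eq_add] at hpq
          rw [← hpq]; abel
        have h2 : l q - l p = (m (l q + c) - m (l p + c)) * l e := by
          rw [← map_sub, h1, map_smul, smul_eq_mul]
        have h3 : m (l q + c) ≤ m (l p + c) := hanti (by linarith)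
        have h4 : m (l q + c) - m (l p + c) = 0 := by nlinarith
        rw [h4, zero_smul, sub_eq_zero] at h1
        exact h1.symm
      intro heq
      rcases le_total (l x) (l y) with h | h
      · exact hxy (key x y heq h)
      · exact hxy (key y x heq.symm h).symm
    · intro z hz
      obtain ⟨a, b, ha, hb, hab, rfl⟩ := hz
      obtain ⟨d, hd, hd'⟩ := hcomb x y a b ha hb hab
      have hz := hfr (a • x + b • y) ⟨a, b, ha, hb, hab, rfl⟩
      rw [hd'] at hz
      rw [hWo.frontier_eq]
      rcases hd.eq_or_lt with rfl | hd0
      · simpa using hz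
      · exact absurd (hrec _ (hW.closure hx.1 hy.1 ha hb hab) d hd0) hz.2
  · intro p v hv hpv
    obtain ⟨a, ha⟩ := hray.2 p v hv hpv
    have hlv := hl p v hpv
    refine ⟨a + m (l (a + p) + c) • e, fun t ht => ?_⟩
    rw [mem_ofPred_eq]
    set z : Plane := a + m (l (a + p) + c) • e + (p + t • v) with hz
    have h1 : l (a + p) ≤ l z := by
      rw [hz]
      simp only [map_add, map_smul, smul_eq_mul]
      nlinarith [hpos (l a + l p + c), mul_nonneg ht hlv, mul_pos (hpos (l a + l p + c)) hle]
    have h2 : m (l z + c) ≤ m (l (a + p) + c) := hanti (by linarith)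
    have h3 : z - m (l z + c) • e = (a + (p + t • v)) + (m (l (a + p) + c) - m (l z + c)) • e := by
      rw [hz]; module
    rw [h3]
    exact hrec' _ (ha t ht) _ (by linarith)
  · intro y hy
    have h := hrec _ (hcl y hy) _ (hpos (l y + c))
    simpa using h

/-- A recession direction `e` and an affine coordinate `l + c` adapted to the strip domain
`closure A \ W`. -/
structure StripCoordinates (A W : Set Plane) (e : Plane) (l : Plane →L[ℝ] ℝ) (c R : ℝ) : Prop where
  norm_eq : ‖e‖ = 1
  add_mem : ∀ y ∈ closure W, ∀ t : ℝ, 0 < t → y + t • e ∈ W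
  pos : 0 < l e
  nonneg : ∀ p v : Plane, (∀ t : ℝ, 0 ≤ t → p + t • v ∈ A) → 0 ≤ l v
  one_le : ∀ y ∈ closure A, 1 ≤ l y + c
  isCompact : ∀ s : ℝ, IsCompact {y | y ∈ closure A ∧ l y + c ≤ s}
  radius_pos : 0 < R
  infDist_le : ∀ y ∈ closure A, infDist y W / R ≤ l y + c
  nonempty : W.Nonempty

/-- `e` is a recession direction of `A`, inherited by `W` through the ray condition, and `l` comes
from `exists_coercive_functional`. The distance to a fixed `w ∈ W` grows at most linearly in `l`: a
far point is scaled towards `w` into a compact sublevel set. This bound yields `R`. -/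
theorem exists_stripCoordinates {A W : Set Plane} (h : IsStripPair A W)
    (hseg : NoSegments (frontier W)) (hray : RayCondition A W) :
    ∃ e l c R, StripCoordinates A W e l c R := by
  have hAo := h.isOpen_outer
  have hA := h.convex_outer
  obtain ⟨a, ha⟩ := h.nonempty
  have hunb : ¬ Bornology.IsBounded (closure A) := fun hb => hray.1 (hb.subset subset_closure)
  obtain ⟨e, he, -, herec⟩ := exists_recession_direction isClosed_closure hA.closure subset_rfl
    hunb 0 0 (by simp)
  have he0 : e ≠ 0 := fun h0 => by simp [h0] at he
  have hline : ∀ p v : Plane, v ≠ 0 → ∃ t : ℝ, p + t • v ∉ closure A := by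
    intro p v hv
    by_contra! hall
    obtain ⟨t, ht⟩ := h.no_line a v hv
    have h1 : ∀ y ∈ closure A, ∀ t : ℝ, 0 ≤ t → y + t • v ∈ closure A := fun y hy t ht =>
      add_smul_mem_closure_of_ray hA (q := p) (fun s _ => hall s) hy ht
    have h2 : ∀ y ∈ closure A, ∀ t : ℝ, 0 ≤ t → y + t • (-v) ∈ closure A := fun y hy t ht =>
      add_smul_mem_closure_of_ray hA (q := p) (fun s _ => by
        rw [smul_neg, ← neg_smul]; exact hall _) hy ht
    apply ht
    rcases le_total 0 t with h0 | h0
    · exact add_smul_mem_of_isOpen hA hAo h1 ha h0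
    · have := add_smul_mem_of_isOpen hA hAo h2 ha (neg_nonneg.2 h0)
      rwa [smul_neg, neg_smul, neg_neg] at this
  obtain ⟨q, hq⟩ := hray.2 a e he0 fun t ht => add_smul_mem_of_isOpen hA hAo herec ha ht
  have hWrec : ∀ y ∈ closure W, ∀ t : ℝ, 0 ≤ t → y + t • e ∈ closure W := fun y hy t ht =>
    add_smul_mem_closure_of_ray h.convex_inner (q := q + a)
      (fun s hs => subset_closure (by rw [add_assoc]; exact hq s hs)) hy ht
  obtain ⟨l, hlpos, hlb⟩ := exists_coercive_functional isClosed_closure hA.closure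
    ⟨a, subset_closure ha⟩ hline
  obtain ⟨B, hB⟩ := isBounded_iff_forall_norm_le.1 (hlb 0)
  have hBl : ∀ y ∈ closure A, 1 ≤ l y + (1 + ‖l‖ * |B|) := by
    intro y hy
    have h0 : 0 ≤ ‖l‖ * |B| := by positivity
    rcases le_or_gt (l y) 0 with hly | hly
    · have h1 := hB y ⟨hy, hly⟩
      have h2 := l.le_opNorm y
      rw [Real.norm_eq_abs] at h2
      have h3 : ‖l‖ * ‖y‖ ≤ ‖l‖ * |B| :=
        mul_le_mul_of_nonneg_left (h1.trans (le_abs_self B)) (norm_nonneg l)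
      linarith [neg_abs_le (l y)]
    · linarith
  set c : ℝ := 1 + ‖l‖ * |B| with hc
  have hcomp : ∀ s : ℝ, IsCompact {y | y ∈ closure A ∧ l y + c ≤ s} := by
    intro s
    refine Metric.isCompact_of_isClosed_isBounded ?_ ((hlb (s - c)).subset ?_)
    · exact isClosed_closure.inter (isClosed_le (l.continuous.add continuous_const) continuous_const)
    · rintro y ⟨hy1, hy2⟩
      exact ⟨hy1, by linarith⟩
  have hw : q + (a + (0 : ℝ) • e) ∈ W := hq 0 le_rfl
  set w : Plane := q + (a + (0 : ℝ) • e) with hwdef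
  have hwA : w ∈ closure A := subset_closure (h.closure_inner_subset (subset_closure hw))
  obtain ⟨B', hB'⟩ := (hcomp (l w + c + 1)).isBounded.subset_closedBall w
  have hdist : ∀ y ∈ closure A, dist y w ≤ max B' 1 * (l y + c) := by
    intro y hy
    have h1 := hBl y hy
    have h2 : B' ≤ max B' 1 := le_max_left _ _
    have h3 : (1 : ℝ) ≤ max B' 1 := le_max_right _ _
    rcases le_or_gt (l y + c) (l w + c + 1) with hle | hgt
    · have h4 : dist y w ≤ B' := hB' ⟨hy, hle⟩
      nlinarith
    · have hpos : 0 < l y - l w := by linarith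
      set τ : ℝ := (l y - l w)⁻¹ with hτ
      have hτ0 : 0 < τ := inv_pos.2 hpos
      have hτ1 : τ ≤ 1 := inv_le_one_of_one_le₀ (by linarith)
      have hτm : τ * (l y - l w) = 1 := inv_mul_cancel₀ hpos.ne'
      have hz : (1 - τ) • w + τ • y ∈ closure A :=
        hA.closure hwA hy (by linarith) hτ0.le (by ring)
      have hlz : l ((1 - τ) • w + τ • y) + c = l w + c + 1 := by
        simp only [map_add, map_smul, smul_eq_mul]
        linarith
      have h4 : dist ((1 - τ) • w + τ • y) w ≤ B' := hB' ⟨hz, hlz.le⟩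
      have h5 : (1 - τ) • w + τ • y - w = τ • (y - w) := by module
      rw [dist_eq_norm, h5, norm_smul, Real.norm_eq_abs, abs_of_pos hτ0, ← dist_eq_norm] at h4
      have h6 : dist y w ≤ B' * (l y - l w) := by
        calc dist y w = (τ * dist y w) * (l y - l w) := by
              rw [mul_right_comm, hτm, one_mul]
          _ ≤ B' * (l y - l w) := mul_le_mul_of_nonneg_right h4 hpos.le
      have h7 := hBl w hwA
      nlinarith
  have hR : 0 < max B' 1 := lt_max_of_lt_right one_pos
  refine ⟨e, l, c, max B' 1, he, ?_, hlpos e he0 herec, ?_, hBl, hcomp, hR, ?_, ⟨w, hw⟩⟩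
  · intro y hy t ht
    exact add_smul_mem_of_noSegments h.convex_inner h.isOpen_inner hseg he0 hWrec hy ht
  · intro p v hpv
    rcases eq_or_ne v 0 with rfl | hv
    · simp
    · exact (hlpos v hv fun z hz t ht => add_smul_mem_closure_of_ray hA
        (fun s hs => subset_closure (hpv s hs)) hz ht).le
  · intro y hy
    rw [div_le_iff₀ hR, mul_comm]
    exact (infDist_le_dist_of_mem hw).trans (hdist y hy)

theorem StripCoordinates.infDist_nonneg_div {A W : Set Plane} {e : Plane} {l : Plane →L[ℝ] ℝ}
    {c R : ℝ} (h : StripCoordinates A W e l c R) (y : Plane) : 0 ≤ infDist y W / R :=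
  div_nonneg infDist_nonneg h.radius_pos.le

theorem StripCoordinates.infDist_pos {A W : Set Plane} {e : Plane} {l : Plane →L[ℝ] ℝ}
    {c R : ℝ} (h : StripCoordinates A W e l c R) {y : Plane} (hy : y ∉ closure W) :
    0 < infDist y W / R := by
  refine div_pos (infDist_nonneg.lt_of_ne fun h0 => hy ?_) h.radius_pos
  exact (mem_closure_iff_infDist_zero h.nonempty).2 h0.symm

theorem StripCoordinates.infDist_eq_zero {A W : Set Plane} {e : Plane} {l : Plane →L[ℝ] ℝ}
    {c R : ℝ} (h : StripCoordinates A W e l c R) {y : Plane} (hy : y ∈ closure W) :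
    infDist y W / R = 0 := by
  rw [(mem_closure_iff_infDist_zero h.nonempty).1 hy, zero_div]

/-- On the compact part of `closure A \ A` below level `s` the distance to `W` has a positive
minimum. This keeps the patches off the outer boundary. -/
theorem StripCoordinates.exists_mem_of_infDist_le {A W : Set Plane} {e : Plane}
    {l : Plane →L[ℝ] ℝ} {c R : ℝ} (h : StripCoordinates A W e l c R) (hAo : IsOpen A)
    (hWA : closure W ⊆ A) (s : ℝ) :
    ∃ r : ℝ, 0 < r ∧ ∀ y ∈ closure A, l y + c ≤ s → infDist y W / R ≤ r → y ∈ A := by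
  set K : Set Plane := {y | y ∈ closure A ∧ l y + c ≤ s} ∩ Aᶜ with hK
  have hKc : IsCompact K := (h.isCompact s).inter_right hAo.isClosed_compl
  rcases K.eq_empty_or_nonempty with hemp | hne
  · refine ⟨1, one_pos, fun y hy hys _ => ?_⟩
    by_contra hyA
    have : y ∈ K := ⟨⟨hy, hys⟩, hyA⟩
    rw [hemp] at this
    exact this
  · obtain ⟨z, hz, hmin⟩ := hKc.exists_isMinOn hne
      (((continuous_infDist_pt W).div_const R).continuousOn)
    have hzpos : 0 < infDist z W / R := h.infDist_pos fun hzW => hz.2 (hWA hzW)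
    refine ⟨infDist z W / R / 2, half_pos hzpos, fun y hy hys hyr => ?_⟩
    by_contra hyA
    have h1 : infDist z W / R ≤ infDist y W / R := hmin (show y ∈ K from ⟨⟨hy, hys⟩, hyA⟩)
    linarith

/-- Uniform continuity of `γ` on a compact neighbourhood of the patch with `W` removed. Two shift
amounts are allowed so that neighbouring patches can be compared with each other and, for amount
`0`, with `γ` itself. -/
theorem StripCoordinates.exists_uniform_shift {A W : Set Plane} {e : Plane}
    {l : Plane →L[ℝ] ℝ} {c R : ℝ} (h : StripCoordinates A W e l c R) (hAo : IsOpen A)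
    (hWo : IsOpen W) {γ : Plane → ℝ} (hγ : ContinuousOn γ (A \ W)) {s r : ℝ}
    (hsr : ∀ y ∈ closure A, l y + c ≤ s → infDist y W / R ≤ r → y ∈ A) {η : ℝ} (hη : 0 < η) :
    ∃ δ : ℝ, 0 < δ ∧ ∀ y ∈ closure A, l y + c ≤ s → infDist y W / R ≤ r →
      ∀ t, 0 ≤ t → t ≤ δ → y - t • e ∈ A ∧ ∀ t', 0 ≤ t' → t' ≤ δ →
        y - t • e ∉ W → y - t' • e ∉ W → |γ (y - t • e) - γ (y - t' • e)| < η := by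
  set K : Set Plane := {y | y ∈ closure A ∧ l y + c ≤ s} ∩ {y | infDist y W / R ≤ r} with hK
  have hKc : IsCompact K := (h.isCompact s).inter_right
    (isClosed_le ((continuous_infDist_pt W).div_const R) continuous_const)
  have hKA : K ⊆ A := fun y hy => hsr y hy.1.1 hy.1.2 hy.2
  obtain ⟨ρ, hρ, hρA⟩ := hKc.exists_cthickening_subset_open hAo hKA
  have hFc : IsCompact (cthickening ρ K \ W) := hKc.cthickening.diff hWo
  have hu := hFc.uniformContinuousOn_of_continuous (hγ.mono (sdiff_subset_sdiff_left hρA))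
  obtain ⟨ρ', hρ', hu'⟩ := Metric.uniformContinuousOn_iff.1 hu η hη
  have hmem : ∀ y ∈ K, ∀ t, 0 ≤ t → t ≤ ρ → y - t • e ∈ cthickening ρ K := by
    intro y hy t ht htρ
    refine mem_cthickening_of_dist_le _ y ρ K hy ?_
    rw [dist_eq_norm, sub_sub_cancel_left, norm_neg, norm_smul, h.norm_eq, mul_one,
      Real.norm_eq_abs, abs_of_nonneg ht]
    exact htρ
  refine ⟨min ρ (ρ' / 2), lt_min hρ (half_pos hρ'), fun y hy hys hyr t ht htδ => ⟨?_, ?_⟩⟩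
  · exact hρA (hmem y ⟨⟨hy, hys⟩, hyr⟩ t ht (htδ.trans (min_le_left _ _)))
  · intro t' ht' htδ' hW1 hW2
    rw [← Real.dist_eq]
    refine hu' _ ⟨hmem y ⟨⟨hy, hys⟩, hyr⟩ t ht (htδ.trans (min_le_left _ _)), hW1⟩
      _ ⟨hmem y ⟨⟨hy, hys⟩, hyr⟩ t' ht' (htδ'.trans (min_le_left _ _)), hW2⟩ ?_
    have h1 : y - t • e - (y - t' • e) = (t' - t) • e := by module
    rw [dist_eq_norm, h1, norm_smul, h.norm_eq, mul_one, Real.norm_eq_abs]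
    have h2 := htδ.trans (min_le_right _ _)
    have h3 := htδ'.trans (min_le_right _ _)
    exact abs_lt.2 ⟨by linarith, by linarith⟩

theorem SegmentConcaveOn.midpoint_le {w : Set Plane} {γ : Plane → ℝ} (h : SegmentConcaveOn w γ)
    {p v : Plane} {t : ℝ} (ht : 0 ≤ t) (hw : ∀ s : ℝ, |s| ≤ t → p + s • v ∈ w) :
    (γ (p + (-t) • v) + γ (p + t • v)) / 2 ≤ γ p := by
  have h1 := h.concaveOn_line (convex_Icc (-t) t) (p := p) (v := v) fun s hs => hw s (abs_le.2 hs)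
  have h2 := h1.2 (x := -t) (y := t) ⟨le_rfl, by linarith⟩ ⟨by linarith, le_rfl⟩
    (by norm_num : (0 : ℝ) ≤ 1 / 2) (by norm_num : (0 : ℝ) ≤ 1 / 2) (by norm_num)
  simp only [smul_eq_mul, mul_neg, neg_add_cancel, zero_smul, add_zero] at h2
  linarith

theorem exists_pos_forall_abs_le_mem {U : Set Plane} {y : Plane} (hU : U ∈ 𝓝 y) (v : Plane) :
    ∃ t : ℝ, 0 < t ∧ t ≤ 1 ∧ ∀ s : ℝ, |s| ≤ t → y + s • v ∈ U := by
  have hcont : Tendsto (fun s : ℝ => y + s • v) (𝓝 0) (𝓝 (y + (0 : ℝ) • v)) :=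
    (by fun_prop : Continuous fun s : ℝ => y + s • v).tendsto 0
  rw [zero_smul, add_zero] at hcont
  obtain ⟨d, hd, hball⟩ := Metric.eventually_nhds_iff.1 (hcont hU)
  refine ⟨min (d / 2) 1, lt_min (half_pos hd) one_pos, min_le_right _ _, fun s hs => ?_⟩
  apply hball
  rw [Real.dist_eq, sub_zero]
  exact lt_of_le_of_lt (hs.trans (min_le_left _ _)) (half_lt_self hd)

theorem infDist_div_midpoint_le {W : Set Plane} (hW : Convex ℝ W) (hne : W.Nonempty) {R : ℝ}
    (hR : 0 < R) (p v : Plane) (t : ℝ) :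
    infDist p W / R ≤ (infDist (p + (-t) • v) W / R + infDist (p + t • v) W / R) / 2 := by
  have h1 := infDist_midpoint_le hW hne (p + (-t) • v) (p + t • v)
  have h2 : (1 / 2 : ℝ) • (p + (-t) • v) + (1 / 2 : ℝ) • (p + t • v) = p := by module
  rw [h2] at h1
  have h3 := div_le_div_of_nonneg_right h1 hR.le
  refine h3.trans (le_of_eq ?_)
  ring

/-- A function concave on the segments of a set `w` is lower semicontinuous along a segment at the
points near which the segment lies in `w`. -/
theorem SegmentConcaveOn.eventually_lt_along {w U : Set Plane} {γ k : Plane → ℝ}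
    (h : SegmentConcaveOn w γ) (hk : Continuous k) {x v : Plane} {t₀ : ℝ}
    (ht₀ : t₀ ∈ Icc (0 : ℝ) 1) (hU : U ∈ 𝓝 (x + t₀ • v))
    (hUw : ∀ t ∈ Icc (0 : ℝ) 1, x + t • v ∈ U → x + t • v ∈ w) {c : ℝ}
    (hc : c < γ (x + t₀ • v) + k (x + t₀ • v)) :
    ∀ᶠ t in 𝓝[Icc 0 1] t₀, c < γ (x + t • v) + k (x + t • v) := by
  obtain ⟨d, hd, -, hdU⟩ := exists_pos_forall_abs_le_mem hU v
  have hmem : ∀ t ∈ Icc (max 0 (t₀ - d)) (min 1 (t₀ + d)), x + t • v ∈ w := by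
    intro t ht
    have h1 := max_le_iff.1 ht.1
    have h2 := le_min_iff.1 ht.2
    refine hUw t ⟨h1.1, h2.1⟩ ?_
    have h3 := hdU (t - t₀) (abs_le.2 ⟨by linarith, by linarith⟩)
    have h4 : x + t₀ • v + (t - t₀) • v = x + t • v := by module
    rwa [h4] at h3
  have hlsc := (h.concaveOn_line (convex_Icc _ _) hmem).lowerSemicontinuousOn_Icc.add
    (((by fun_prop : Continuous fun t : ℝ => k (x + t • v)).lowerSemicontinuous).lowerSemicontinuousOn
      _)
  have h5 := hlsc t₀ ⟨max_le ht₀.1 (by linarith), le_min ht₀.2 (by linarith)⟩ c hc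
  rw [eventually_nhdsWithin_iff] at h5 ⊢
  filter_upwards [h5, Icc_mem_nhds (by linarith : t₀ - d < t₀) (by linarith : t₀ < t₀ + d)]
    with t h6 h7 h8
  exact h6 ⟨max_le h8.1 h7.1, le_min h8.2 h7.2⟩

theorem ContinuousOn.eventually_lt_along {S B : Set Plane} {g : Plane → ℝ}
    (hg : ContinuousOn g S) {x v : Plane} {t₀ : ℝ} (hS : x + t₀ • v ∈ S) {N : Set Plane}
    (hN : N ∈ 𝓝 (x + t₀ • v)) (hBS : B ∩ N ⊆ S) {c : ℝ} (hc : c < g (x + t₀ • v)) (T : Set ℝ) :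
    ∀ᶠ t in 𝓝[T] t₀, x + t • v ∈ B → c < g (x + t • v) := by
  have h1 : ∀ᶠ z in 𝓝[S] (x + t₀ • v), c < g z := (hg _ hS).eventually_const_lt hc
  rw [eventually_nhdsWithin_iff] at h1
  have hcont : Tendsto (fun t : ℝ => x + t • v) (𝓝[T] t₀) (𝓝 (x + t₀ • v)) :=
    ((by fun_prop : Continuous fun t : ℝ => x + t • v).tendsto t₀).mono_left nhdsWithin_le_nhds
  filter_upwards [hcont.eventually h1, hcont hN] with t h2 h3 h4
  exact h2 (hBS ⟨h4, h3⟩)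

/-! ### Gluing the competitor on the extension, and the conclusion. -/

theorem exists_extension_majorant {A W : Set Plane} {e : Plane} {l : Plane →L[ℝ] ℝ} {c R : ℝ}
    (h : StripCoordinates A W e l c R) (hAo : IsOpen A)
    (hA_seg : NoSegments (frontier A)) (hW : Convex ℝ W) (hWo : IsOpen W)
    (hseg : NoSegments (frontier W)) (hWA : closure W ⊆ A) (hray : RayCondition A W)
    {γ : Plane → ℝ} (hγ : SegmentConcaveOn (stripDomain A W) γ) {ε : ℝ} (hε : 0 < ε) :
    ∃ (V : Set Plane) (H : Plane → ℝ), IsExtension A W V ∧ SegmentConcaveOn (stripDomain A V) H ∧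
      (∀ y ∈ stripDomain A W, H y ≤ γ y + ε * (l y + c)) ∧ ∀ y ∈ closure A \ A, γ y ≤ H y := by
  have hγc : ContinuousOn γ (A \ W) := hγ.continuousOn_sdiff hAo
    (sdiff_subset_sdiff_left subset_closure) hW hWo hseg
  -- the thickness of the patches
  choose r₀ hr₀ hr₀A using fun n : ℕ => h.exists_mem_of_infDist_le hAo hWA ((n : ℝ) + 1)
  obtain ⟨r, hr, hr4, hrr₀⟩ := exists_quarter_decreasing_le hr₀
  have hrA : ∀ n : ℕ, ∀ y ∈ closure A, l y + c ≤ (n : ℝ) + 1 → infDist y W / R ≤ r n → y ∈ A :=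
    fun n y hy h1 h2 => hr₀A n y hy h1 (h2.trans (hrr₀ n))
  -- the slopes of the affine corrections
  obtain ⟨α, hα, hα4, hαr⟩ := exists_quarter_decreasing_le
    (fun n => by have := hr n; positivity : ∀ n, 0 < ε * r n / 4)
  -- the shifts
  choose δ₀ hδ₀ hδ₀' using fun n : ℕ => h.exists_uniform_shift hAo hWo hγc (hrA n) (hα (n + 1))
  obtain ⟨δ, hδ, hδ4, hδδ₀⟩ := exists_quarter_decreasing_le hδ₀
  have hδanti : Antitone δ := antitone_nat_of_succ_le fun n => by linarith [hδ4 n, hδ n]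
  obtain ⟨m, hm, hmc, hmanti, hmpos, hmδ⟩ := exists_convex_antitone_le hδ hδanti
  set V : Set Plane := {y | y - m (l y + c) • e ∈ W} with hV
  have hext : IsExtension A W V :=
    isExtension_shift hA_seg hW hWo hseg hray h.add_mem h.pos h.nonneg hm hmc hmanti hmpos
  set X : Set Plane := stripDomain A V with hX
  have hWX : stripDomain A W ⊆ X := fun y hy =>
    ⟨hy.1, fun hyV => hy.2 (hext.closure_subset (subset_closure hyV))⟩
  -- Here `m ≤ δ n`, so pulling back by `δ n` retreats at least as far as the shift defining `V`.
  have hshift : ∀ y ∈ X, ∀ n : ℕ, (n : ℝ) ≤ l y + c + 1 → y - δ n • e ∉ W := by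
    intro y hy n hn hmem
    apply hy.2
    have h1 := hmδ n _ hn
    have h2 : y - m (l y + c) • e = (y - δ n • e) + (δ n - m (l y + c)) • e := by module
    rw [hV, mem_ofPred_eq, h2]
    rcases (sub_nonneg.2 h1).eq_or_lt with h0 | h0
    · rw [← h0, zero_smul, add_zero]; exact hmem
    · exact h.add_mem _ (subset_closure hmem) _ h0
  set D : Plane → ℝ := fun y => infDist y W / R with hD
  have hDc : Continuous D := (continuous_infDist_pt W).div_const R
  have hLc : Continuous fun y : Plane => l y + c := l.continuous.add continuous_const
  -- the patches and the functions on them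
  set B : ℕ → Set Plane := fun n => {y | (n : ℝ) - 1 ≤ l y + c ∧ l y + c ≤ n + 1 ∧ D y ≤ r n}
    with hB
  have hBc : ∀ n, IsClosed (B n) := fun n =>
    (isClosed_le continuous_const hLc).inter
      ((isClosed_le hLc continuous_const).inter (isClosed_le hDc continuous_const))
  set P : Option ℕ → Set Plane := fun i => i.elim (stripDomain A W) fun n => X ∩ B n with hP
  -- The term `-εD` is concave, vanishes on `closure W` and favours the old piece away from `W`. The
  -- affine term of band `n` falls from `2αₙ` to `0` as the level goes from `n - 1` to `n + 1`,
  -- which hands over to the neighbouring bands.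
  set g : Option ℕ → Plane → ℝ := fun i => i.elim (fun y => γ y + ε * (l y + c - D y))
    fun n y => γ (y - δ n • e) + (ε * (l y + c) - α n * (n + 1 - (l y + c))) with hg
  have hfin : ∀ y : Plane, ∃ I : Set (Option ℕ), I.Finite ∧
      ∀ᶠ z in 𝓝 y, ∀ i, z ∈ P i → i ∈ I := by
    intro y
    obtain ⟨N, hN⟩ := exists_nat_gt (l y + c + 1)
    refine ⟨insert none (some '' Iic N), ((finite_Iic N).image _).insert _, ?_⟩
    have h1 : ∀ᶠ z in 𝓝 y, l z + c < N - 1 :=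
      (hLc.tendsto y).eventually_lt_const (by linarith)
    filter_upwards [h1] with z hz i hi
    cases i with
    | none => exact mem_insert _ _
    | some n =>
      refine mem_insert_of_mem _ (mem_image_of_mem _ ?_)
      have h2 : (n : ℝ) - 1 ≤ l z + c := hi.2.1
      have h3 : (n : ℝ) ≤ N := by linarith
      exact_mod_cast h3
  have hceil : ∀ y ∈ closure A, (⌈l y + c⌉₊ : ℝ) - 1 < l y + c ∧ l y + c ≤ ⌈l y + c⌉₊ := by
    intro y hy
    have h1 := h.one_le y hy
    exact ⟨by linarith [Nat.ceil_lt_add_one (by linarith : 0 ≤ l y + c)], Nat.le_ceil _⟩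
  have hcov : ∀ y ∈ X, y ∈ closure W → y ∈ P (some ⌈l y + c⌉₊) := by
    intro y hy hyW
    obtain ⟨h1, h2⟩ := hceil y hy.1
    refine ⟨hy, h1.le, by linarith, ?_⟩
    rw [hD]
    dsimp only
    rw [h.infDist_eq_zero hyW]
    exact (hr _).le
  have hmin : ∀ y, y ∈ X → ∃ i, y ∈ P i ∧ ∀ j, y ∈ P j → g i y ≤ g j y := by
    intro y hy
    obtain ⟨I, hI, hev⟩ := hfin y
    have hfinite : {i | y ∈ P i}.Finite := hI.subset fun i hi => hev.self_of_nhds i hi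
    refine Set.exists_min_image _ (fun i => g i y) hfinite ?_
    by_cases hyW : y ∈ W
    · exact ⟨_, hcov y hy (subset_closure hyW)⟩
    · exact ⟨none, hy.1, hyW⟩
  choose! i₀ hi₀ hi₀min using hmin
  set H : Plane → ℝ := fun y => g (i₀ y) y with hH
  -- a minimizer on a shrinking patch is attained away from its edges
  have hedge₀ : ∀ y ∈ P none, (∀ j, y ∈ P j → g none y ≤ g j y) → y ∉ closure W := by
    intro y hy hym hyW
    obtain ⟨h1, h2⟩ := hceil y hy.1
    set n := ⌈l y + c⌉₊ with hn
    -- With `n = ⌈L⌉` the correction of band `n` is at least `αₙ`, whereas the continuity error is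
    -- below `α(n+1) ≤ αₙ/4`; so band `n` beats the old piece on `closure W`.
    have h3 := hym _ (hcov y (hWX hy) hyW)
    have h4 := (hδ₀' n y hy.1 (by linarith) (by rw [h.infDist_eq_zero hyW]; exact (hr n).le)
      (δ n) (hδ n).le (hδδ₀ n)).2 0 le_rfl (hδ₀ n).le
      (hshift y (hWX hy) n (by linarith)) (by simpa using hy.2)
    have h5 : D y = 0 := h.infDist_eq_zero hyW
    simp only [hg, Option.elim_none, Option.elim_some, h5, zero_smul, sub_zero] at h3 h4
    have h6 := (abs_lt.1 h4).2
    have h7 := hα4 n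
    have h8 := hα n
    nlinarith
  have hedge : ∀ n, ∀ y ∈ P (some n), (∀ j, y ∈ P j → g (some n) y ≤ g j y) →
      (n : ℝ) - 1 < l y + c ∧ l y + c < n + 1 ∧ D y < r n := by
    rintro n y ⟨hyX, hy1, hy2, hy3⟩ hym
    have hn := hyX.1
    have hL := h.one_le y hn
    have hα0 := hα n
    have hα1 := hα (n + 1)
    have hα2 := hα4 n
    have hαr' := hαr n
    have hr' := hr n
    have hS1 := hshift y hyX n (by linarith)
    have key : y ∉ W → |γ (y - δ n • e) - γ y| < α (n + 1) := by
      intro hyW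
      have := (hδ₀' n y hn hy2 hy3 (δ n) (hδ n).le (hδδ₀ n)).2 0 le_rfl (hδ₀ n).le hS1
        (by simpa using hyW)
      simpa using this
    have hDW : 0 < D y → y ∉ W := by
      intro hDpos hyW
      rw [hD] at hDpos
      dsimp only at hDpos
      rw [h.infDist_eq_zero (subset_closure hyW)] at hDpos
      exact lt_irrefl _ hDpos
    have hnone : 0 < D y → g (some n) y ≤ g none y := fun hDpos => hym none ⟨hn, hDW hDpos⟩
    simp only [hg, Option.elim_none, Option.elim_some] at hnone
    refine ⟨hy1.lt_of_ne fun heq => ?_, hy2.lt_of_ne fun heq => ?_, hy3.lt_of_ne fun heq => ?_⟩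
    -- Lower edge `L = n - 1 = k`: band `k` has correction `α k`, exceeding `2α(k+1)` plus the
    -- error. The case `n = 0` is excluded by `1 ≤ L`.
    · obtain ⟨k, rfl⟩ : ∃ k, n = k + 1 := by
        refine Nat.exists_eq_succ_of_ne_zero fun h0 => ?_
        rw [h0] at heq
        norm_num at heq
        linarith
      push_cast at heq hy1 hy2 hym
      have hk4 := hα4 k
      have hrk : r (k + 1) ≤ r k := by linarith [hr4 k, hr k]
      have h1 := hym (some k) ⟨hyX, by linarith, by linarith, hy3.trans hrk⟩
      have h2 := (hδ₀' k y hn (by linarith) (hy3.trans hrk) (δ (k + 1)) (hδ _).le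
        ((hδanti (Nat.le_succ k)).trans (hδδ₀ k))).2 (δ k) (hδ k).le (hδδ₀ k) hS1
        (hshift y hyX k (by linarith))
      simp only [hg, Option.elim_some] at h1
      push_cast at h1
      have h3 := (abs_lt.1 h2).1
      have h4 : l y + c = k := by linarith
      rw [h4] at h1
      linarith
    -- Upper edge: band `n` has correction `0`. Band `n + 1`, if available, has `α(n+1)`, above the
    -- error; otherwise `D > r(n+1)` and the old piece wins because `εr(n+1) ≥ 4α(n+1)`.
    · by_cases hDr : D y ≤ r (n + 1)
      · have h1 := hym (some (n + 1)) ⟨hyX, by push_cast; linarith, by push_cast; linarith, hDr⟩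
        have h2 := (hδ₀' n y hn hy2 hy3 (δ n) (hδ n).le (hδδ₀ n)).2 (δ (n + 1)) (hδ _).le
          ((hδanti (Nat.le_succ n)).trans (hδδ₀ n)) hS1
          (hshift y hyX (n + 1) (by push_cast; linarith))
        simp only [hg, Option.elim_some] at h1
        push_cast at h1
        rw [heq] at h1
        have h3 := (abs_lt.1 h2).1
        linarith
      · push Not at hDr
        have hDpos := (hr (n + 1)).trans hDr
        have h1 := hnone hDpos
        have h2 := (abs_lt.1 (key (hDW hDpos))).1
        have h3 := hαr (n + 1)
        rw [heq] at h1
        nlinarith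
    -- Outer edge `D = r n`: the old piece wins, since `ε r n ≥ 4αₙ` exceeds the correction, at most
    -- `2αₙ`, plus the error.
    · have hDpos : 0 < D y := by rw [heq]; exact hr'
      have h1 := hnone hDpos
      have h2 := (abs_lt.1 (key (hDW hDpos))).1
      rw [heq] at h1
      nlinarith
  refine ⟨V, H, hext, ?_, ?_, ?_⟩
  · refine segmentConcaveOn_of_minimum (A := P) (g := g) (fun y hy => ⟨i₀ y, hi₀ y hy, rfl⟩)
      (fun y hy i hi => hi₀min y hy i hi) ?_ (fun y _ => hfin y) ?_
    · intro i y hy hi hHi v hv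
      have hym : ∀ j, y ∈ P j → g i y ≤ g j y := fun j hj => by
        rw [← hHi]; exact hi₀min y hy j hj
      cases i with
      | none =>
        have hyW := hedge₀ y hi hym
        obtain ⟨t, ht0, ht1, ht⟩ := exists_pos_forall_abs_le_mem
          (isClosed_closure.isOpen_compl.mem_nhds hyW) v
        have hmem : ∀ s : ℝ, |s| ≤ t → y + s • v ∈ stripDomain A W := fun s hs =>
          ⟨(hv s (abs_le.1 (hs.trans ht1))).1, fun hsW => ht s hs (subset_closure hsW)⟩
        refine ⟨t, ht0, ht1, hmem _ (by rw [abs_neg, abs_of_pos ht0]),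
          hmem _ (by rw [abs_of_pos ht0]), ?_⟩
        have h1 := hγ.midpoint_le ht0.le hmem
        have h2 := infDist_div_midpoint_le hW h.nonempty h.radius_pos y v t
        simp only [hg, hD, Option.elim_none, map_add, map_smul, smul_eq_mul]
        nlinarith
      | some n =>
        obtain ⟨hy1, hy2, hy3⟩ := hedge n y hi hym
        have hU : {z | (n : ℝ) - 1 < l z + c} ∩ ({z | l z + c < n + 1} ∩ {z | D z < r n}) ∈ 𝓝 y :=
          ((isOpen_lt continuous_const hLc).inter ((isOpen_lt hLc continuous_const).inter
            (isOpen_lt hDc continuous_const))).mem_nhds ⟨hy1, hy2, hy3⟩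
        obtain ⟨t, ht0, ht1, ht⟩ := exists_pos_forall_abs_le_mem hU v
        have hXs : ∀ s : ℝ, |s| ≤ t → y + s • v ∈ X := fun s hs => hv s (abs_le.1 (hs.trans ht1))
        have hmem : ∀ s : ℝ, |s| ≤ t → y + s • v ∈ P (some n) := fun s hs =>
          ⟨hXs s hs, (ht s hs).1.le, (ht s hs).2.1.le, (ht s hs).2.2.le⟩
        refine ⟨t, ht0, ht1, hmem _ (by rw [abs_neg, abs_of_pos ht0]),
          hmem _ (by rw [abs_of_pos ht0]), ?_⟩
        have hmem' : ∀ s : ℝ, |s| ≤ t → (y - δ n • e) + s • v ∈ stripDomain A W := by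
          intro s hs
          have e1 : (y - δ n • e) + s • v = (y + s • v) - δ n • e := by module
          rw [e1]
          obtain ⟨h1, h2, h3, h4⟩ := hmem s hs
          exact ⟨subset_closure (hδ₀' n _ h1.1 h3 h4 (δ n) (hδ n).le (hδδ₀ n)).1,
            hshift _ h1 n (by linarith)⟩
        have h1 := hγ.midpoint_le ht0.le hmem'
        have e1 : ∀ s : ℝ, (y - δ n • e) + s • v = (y + s • v) - δ n • e := fun s => by module
        rw [e1, e1] at h1
        simp only [hg, Option.elim_some, map_add, map_smul, smul_eq_mul]
        linarith
    · intro i x y hxy t₀ ht₀ a ha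
      have hXs : ∀ t ∈ Icc (0 : ℝ) 1, x + t • (y - x) ∈ X := by
        intro t ht
        apply hxy
        rw [segment_eq_image']
        exact mem_image_of_mem _ ht
      have hp := hXs t₀ ht₀
      set p := x + t₀ • (y - x) with hpdef
      cases i with
      | none =>
        by_cases hpA : p ∈ A
        · by_cases hpW : p ∈ W
          · have hcont : Tendsto (fun t : ℝ => x + t • (y - x)) (𝓝[Icc 0 1] t₀) (𝓝 p) :=
              ((by fun_prop : Continuous fun t : ℝ => x + t • (y - x)).tendsto t₀).mono_left
                nhdsWithin_le_nhds
            filter_upwards [hcont (hWo.mem_nhds hpW)] with t ht ht'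
            exact absurd ht ht'.2
          · have hgc : ContinuousOn (g none) (A \ W) :=
              hγc.add (continuous_const.mul (hLc.sub hDc)).continuousOn
            exact hgc.eventually_lt_along (N := A) ⟨hpA, hpW⟩ (hAo.mem_nhds hpA)
              (fun z hz => ⟨hz.2, hz.1.2⟩) (ha.trans_le (hi₀min p hp none ⟨hp.1, hpW⟩)) _
        -- At the outer boundary continuity of `γ` is not available; lower semicontinuity along the
        -- given segment follows from one-dimensional concavity.
        · have hpW : p ∉ closure W := fun hpW => hpA (hWA hpW)
          have h1 := hγ.eventually_lt_along (k := fun y => ε * (l y + c - D y))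
            (continuous_const.mul (hLc.sub hDc)) ht₀ (isClosed_closure.isOpen_compl.mem_nhds hpW)
            (fun t ht htU => ⟨(hXs t ht).1, fun hW' => htU (subset_closure hW')⟩)
            (ha.trans_le (hi₀min p hp none ⟨hp.1, fun hW' => hpW (subset_closure hW')⟩))
          filter_upwards [h1] with t ht _
          exact ht
      | some n =>
        by_cases hpB : p ∈ B n
        · have hgc : ContinuousOn (g (some n)) (P (some n)) := by
            refine ContinuousOn.add ?_ ((continuous_const.mul hLc).sub
              (continuous_const.mul (continuous_const.sub hLc))).continuousOn
            refine hγc.comp (by fun_prop : Continuous fun y : Plane => y - δ n • e).continuousOn ?_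
            intro z hz
            exact ⟨(hδ₀' n z hz.1.1 hz.2.2.1 hz.2.2.2 (δ n) (hδ n).le (hδδ₀ n)).1,
              hshift z hz.1 n (by linarith [hz.2.1])⟩
          exact hgc.eventually_lt_along (N := univ) ⟨hp, hpB⟩ univ_mem inter_subset_left
            (ha.trans_le (hi₀min p hp _ ⟨hp, hpB⟩)) _
        · have hcont : Tendsto (fun t : ℝ => x + t • (y - x)) (𝓝[Icc 0 1] t₀) (𝓝 p) :=
            ((by fun_prop : Continuous fun t : ℝ => x + t • (y - x)).tendsto t₀).mono_left
              nhdsWithin_le_nhds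
          filter_upwards [hcont ((hBc n).isOpen_compl.mem_nhds hpB)] with t ht ht'
          exact absurd ht'.2 ht
  · intro y hy
    have h1 := hi₀min y (hWX hy) none hy
    have h2 := h.infDist_nonneg_div y
    simp only [hg, hD, Option.elim_none] at h1
    simp only [hH]
    refine h1.trans ?_
    nlinarith
  · intro y hy
    have hyV : y ∉ V := fun hyV => hy.2 (hWA (subset_closure (hext.closure_subset (subset_closure hyV))))
    have h1 := hi₀ y ⟨hy.1, hyV⟩
    simp only [hH]
    cases hi : i₀ y with
    | none =>
      -- `D ≤ L` makes the correction of the old piece nonnegative.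
      have h2 := h.infDist_le y hy.1
      simp only [hg, hD, Option.elim_none]
      nlinarith
    | some n =>
      rw [hi] at h1
      exact absurd (hrA n y hy.1 h1.2.2.1 h1.2.2.2) hy.2

theorem LocallyConcaveOn.mono {w w' : Set Plane} {G : Plane → EReal} (h : LocallyConcaveOn w' G)
    (hw : w ⊆ w') : LocallyConcaveOn w G :=
  ⟨fun x hx => h.1 x (hw hx), fun x y hxy => h.2 x y (hxy.trans hw)⟩

/-- The competitor equal to `f` on the fixed boundary and `⊤` elsewhere is locally concave, because
no nondegenerate segment of `w` has a fixed boundary point in its interior. -/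
theorem minimalLocallyConcave_le_of_mem_fixedBoundary {w : Set Plane} (f : Plane → ℝ) {x : Plane}
    (hx : x ∈ fixedBoundary w) : minimalLocallyConcave w f x ≤ f x := by
  classical
  set G : Plane → EReal := fun y => if y ∈ fixedBoundary w then (f y : EReal) else ⊤ with hG
  have hGx : G x = f x := if_pos hx
  rw [← hGx]
  refine iInf₂_le G ⟨⟨fun y _ => ?_, fun y z hyz a b ha hb hab => ?_⟩, fun y hy => ?_⟩
  · by_cases hy : y ∈ fixedBoundary w <;> simp [hG, hy]
  · by_cases hp : a • y + b • z ∈ fixedBoundary w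
    · have hyz' : y = z := by
        by_contra hne
        exact hp.2 y z hne ⟨a, b, ha, hb, hab, rfl⟩
          ((openSegment_subset_segment ℝ y z).trans (hyz.trans subset_closure))
      subst hyz'
      rw [← add_smul, hab, one_smul] at hp ⊢
      simp only [hG, if_pos hp]
      have : a * f y + b * f y ≤ f y := by rw [← add_mul, hab, one_mul]
      exact_mod_cast this
    · simp only [hG, if_neg hp, le_top]
  · simp only [hG, if_pos hy, le_refl]

theorem mainTheorem6 (Ω₀ Ω₁ : Set Plane) (hΩ : IsStripPair Ω₀ Ω₁)
    (h_segments₀ : NoSegments (frontier Ω₀)) (h_segments₁ : NoSegments (frontier Ω₁))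
    (h_smooth₁ : IsC2Curve (frontier Ω₁))
    (h_ray : RayCondition Ω₀ Ω₁)
    (h_fixed : IsC2Curve (fixedBoundary (stripDomain Ω₀ Ω₁)))
    (f : Plane → ℝ) (hf : ContinuousOn f (fixedBoundary (stripDomain Ω₀ Ω₁))) :
    ∀ x ∈ stripDomain Ω₀ Ω₁,
      minimalLocallyConcave (stripDomain Ω₀ Ω₁) f x =
        ⨅ (V : Set Plane) (_ : IsExtension Ω₀ Ω₁ V),
          minimalLocallyConcave (stripDomain Ω₀ V) f x := by
  have hAo := hΩ.isOpen_outer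
  have hA := hΩ.convex_outer
  have hfb : fixedBoundary (stripDomain Ω₀ Ω₁) = frontier Ω₀ :=
    fixedBoundary_stripDomain hA hAo h_segments₀ hΩ.convex_inner hΩ.isOpen_inner
      hΩ.closure_inner_subset
  have hfbV : ∀ V, IsExtension Ω₀ Ω₁ V → fixedBoundary (stripDomain Ω₀ V) = frontier Ω₀ :=
    fun V hV => fixedBoundary_stripDomain hA hAo h_segments₀ hV.convex hV.isOpen
      (hV.closure_subset.trans (subset_closure.trans hΩ.closure_inner_subset))
  obtain ⟨e, l, c, R, hcoord⟩ := exists_stripCoordinates hΩ h_segments₁ h_ray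
  have he0 : e ≠ 0 := fun h0 => by simpa [h0] using hcoord.norm_eq
  intro x hx
  apply le_antisymm
  · refine le_iInf₂ fun V hV => le_iInf₂ fun G hG => iInf₂_le G ⟨hG.1.mono ?_, ?_⟩
    · exact fun y hy => ⟨hy.1, fun hyV => hy.2 (hV.closure_subset (subset_closure hyV))⟩
    · rw [hfb, ← hfbV V hV]
      exact hG.2
  · refine le_iInf₂ fun G hG => ?_
    by_cases hxA : x ∈ Ω₀
    swap
    -- On the outer boundary any extension will do; the zero function is used only to obtain one.
    · obtain ⟨V, -, hV, -⟩ := exists_extension_majorant hcoord hAo h_segments₀ hΩ.convex_inner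
        hΩ.isOpen_inner h_segments₁ hΩ.closure_inner_subset h_ray (γ := fun _ => 0)
        (fun _ _ _ _ _ _ _ _ => by simp) one_pos
      have hxf : x ∈ frontier Ω₀ := by
        rw [hAo.frontier_eq]
        exact ⟨hx.1, hxA⟩
      calc _ ≤ minimalLocallyConcave (stripDomain Ω₀ V) f x := iInf₂_le V hV
        _ ≤ f x := minimalLocallyConcave_le_of_mem_fixedBoundary f (by rwa [hfbV V hV])
        _ ≤ G x := hG.2 x (by rwa [hfb])
    · by_cases hGx : G x = ⊤
      · rw [hGx]
        exact le_top
      have htop := hG.1.ne_top hA hAo hΩ.no_line hΩ.convex_inner hΩ.isOpen_inner h_segments₁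
        hΩ.closure_inner_subset he0 hcoord.add_mem ⟨hxA, hx.2⟩ hGx
      have hcoe : ∀ y ∈ stripDomain Ω₀ Ω₁, ((G y).toReal : EReal) = G y := fun y hy =>
        EReal.coe_toReal (htop y hy) (hG.1.1 y hy)
      rw [← EReal.le_of_forall_lt_iff_le]
      intro z hz
      rw [← hcoe x hx] at hz
      have hz' : (G x).toReal < z := by exact_mod_cast hz
      have hL : 1 ≤ l x + c := hcoord.one_le x hx.1
      obtain ⟨V, H, hV, hH, hHle, hHge⟩ := exists_extension_majorant hcoord hAo h_segments₀
        hΩ.convex_inner hΩ.isOpen_inner h_segments₁ hΩ.closure_inner_subset h_ray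
        (hG.1.segmentConcaveOn_toReal htop)
        -- This `ε` makes the loss `ε(l x + c)` at `x` exactly `z - G x`.
        (ε := (z - (G x).toReal) / (l x + c)) (div_pos (by linarith) (by linarith))
      refine (iInf₂_le V hV).trans ((iInf₂_le (fun y => (H y : EReal))
        ⟨hH.locallyConcaveOn, fun y hy => ?_⟩).trans ?_)
      · have h1 := hHle x hx
        rw [div_mul_cancel₀ _ (by linarith : l x + c ≠ 0)] at h1
        have h2 : H x ≤ z := by linarith
        exact EReal.coe_le_coe_iff.2 h2
      · rw [hfbV V hV] at hy
        have hy' := hy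
        rw [hAo.frontier_eq] at hy'
        have hyX : y ∈ stripDomain Ω₀ Ω₁ :=
          ⟨hy'.1, fun hyW => hy'.2 (hΩ.closure_inner_subset (subset_closure hyW))⟩
        refine (hG.2 y (by rwa [hfb])).trans ?_
        rw [← hcoe y hyX]
        exact EReal.coe_le_coe_iff.2 (hHge y hy')
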